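/- Let $\mathbb K$ be a field and $V$ a $\mathbb K$-vector space. A \emph{compatible associative algebra} is a $\mathbb K$-vector space $A$ with two bilinear associative products $\cdot$ and $\circ$ (no units are assumed) whose sum $x * y := x\cdot y + x\circ y$ is also associative. Let ${\rm As}^2(V)$ be the free compatible associative algebra on $V$, and let $\Delta\colon {\rm As}^2(V)\to {\rm As}^2(V)\otimes {\rm As}^2(V)$ be its canonical coproduct, that is, the unique linear map with $\Delta(v)=0$ for $v\in V$ and, writing $\Delta(x)=x_{(1)}\otimes x_{(2)}$, $$\Delta(x\cdot y)=x_{(1)}\otimes (x_{(2)}\cdot y)+(x\cdot y_{(1)})\otimes y_{(2)}+x\otimes y,$$ $$\Delta(x\circ y)=x_{(1)}\otimes (x_{(2)}\circ y)+(x\circ y_{(1)})\otimes y_{(2)}+x\otimes y$$ for all $x,y$. An \emph{$\mathcal N$-algebra} is a $\mathbb K$-vector space $A$ with $n$-linear operations $N_n\colon A^{\otimes n}\to A$, for $n\ge 2$, such that \begin{enumerate} \item for $n\ge 2$, $$N_n(x_1,\dots,x_{n-1},N_2(x_n,x_{n+1}))=\sum_{i=1}^{n-1}N_{i+1}(x_1,\dots,x_{i-1},N_{n-i+1}(x_i,\dots,x_n),x_{n+1});$$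 \item for $n\ge 3$, $$N_2(x_1,N_n(x_2,\dots,x_{n+1}))=N_n(N_2(x_1,x_2),x_3,\dots,x_{n+1})-\sum_{i=3}^{n}N_i(x_1,N_{n+2-i}(x_2,\dots,x_{n+3-i}),x_{n+4-i},\dots,x_{n+1});$$ \item for $r,n\ge 3$, $$\begin{aligned}N_n(x,y_1,\dots,y_{n-2},N_r(z,t_1,\dots,t_{r-2},w))={}&N_r(N_n(x,y_1,\dots,y_{n-2},z),t_1,\dots,t_{r-2},w)\\&+\sum_{i=1}^{n-2}N_{r+i}(x,y_1,\dots,y_{i-1},N_{n-i}(y_i,\dots,y_{n-2},z),t_1,\dots,t_{r-2},w)\\&-\sum_{i=1}^{r-2}N_{n+r-i-1}(x,y_1,\dots,y_{n-2},N_{i+1}(z,t_1,\dots,t_i),t_{i+1},\dots,t_{r-2},w).\end{aligned}$$ \end{enumerate} Let $\mathcal N(V)$ be the free $\mathcal N$-algebra on $V$. For a vector space $W$, let $T^c(W)=\bigoplus_{n\ge 1}W^{\otimes n}$ be the (non-counital) cofree conilpotent coassociative coalgebra on $W$, with the deconcatenation coproduct $$w_1\otimes\dots\otimes w_n\mapsto\sum_{i=1}^{n-1}(w_1\otimes\dots\otimes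 w_i)\otimes(w_{i+1}\otimes\dots\otimes w_n).$$ \textbf{Theorem.} The coalgebra $({\rm As}^2(V),\Delta)$ is isomorphic to $T^c(\mathcal N(V))$: there is a linear isomorphism ${\rm As}^2(V)\to T^c(\mathcal N(V))$ that commutes with the coproducts. -/

import Mathlib

open scoped TensorProduct

noncomputable section

/-! ## Compatible associative algebras -/

/-- A compatible associative algebra over `K`: a vector space with two bilinear associative
products whose sum is associative as well. No unit is assumed. -/
class CompatAssocAlgebra (K : Type*) (A : Type*) [Field K] [AddCommGroup A] [Module K A] where
  /-- the first product -/
  dot : A →ₗ[K] A →ₗ[K] A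
  /-- the second product -/
  circ : A →ₗ[K] A →ₗ[K] A
  dot_assoc : ∀ x y z : A, dot (dot x y) z = dot x (dot y z)
  circ_assoc : ∀ x y z : A, circ (circ x y) z = circ x (circ y z)
  sum_assoc : ∀ x y z : A,
    (dot + circ) ((dot + circ) x y) z = (dot + circ) x ((dot + circ) y z)

/-! ## The free compatible associative algebra -/

namespace FreeCompat

/-- Formal expressions in elements of `V`, linear combinations and two binary products. -/
inductive Pre (K : Type*) (V : Type*) where
  | of : V → Pre K V
  | zero : Pre K V
  | add : Pre K V → Pre K V → Pre K V
  | smul : K → Pre K V → Pre K V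
  | dot : Pre K V → Pre K V → Pre K V
  | circ : Pre K V → Pre K V → Pre K V

/-- The formal sum of the two products. -/
def Pre.star {K V : Type*} (a b : Pre K V) : Pre K V := (a.dot b).add (a.circ b)

/-- The congruence generated by the axioms of vector spaces, linearity of `V → As²(V)`,
bilinearity of both products, and associativity of both products and of their sum. -/
inductive Rel (K : Type*) (V : Type*) [Field K] [AddCommGroup V] [Module K V] :
    Pre K V → Pre K V → Prop where
  | refl (a : Pre K V) : Rel K V a a
  | symm {a b : Pre K V} : Rel K V a b → Rel K V b a
  | trans {a b c : Pre K V} : Rel K V a b → Rel K V b c → Rel K V a c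
  | congr_add {a a' b b' : Pre K V} : Rel K V a a' → Rel K V b b' → Rel K V (a.add b) (a'.add b')
  | congr_smul (c : K) {a a' : Pre K V} : Rel K V a a' → Rel K V (a.smul c) (a'.smul c)
  | congr_dot {a a' b b' : Pre K V} : Rel K V a a' → Rel K V b b' → Rel K V (a.dot b) (a'.dot b')
  | congr_circ {a a' b b' : Pre K V} : Rel K V a a' → Rel K V b b' → Rel K V (a.circ b) (a'.circ b')
  | add_assoc (a b c : Pre K V) : Rel K V ((a.add b).add c) (a.add (b.add c))
  | add_comm (a b : Pre K V) : Rel K V (a.add b) (b.add a)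
  | zero_add (a : Pre K V) : Rel K V (Pre.zero.add a) a
  | smul_add (c : K) (a b : Pre K V) : Rel K V ((a.add b).smul c) ((a.smul c).add (b.smul c))
  | add_smul (c d : K) (a : Pre K V) : Rel K V (a.smul (c + d)) ((a.smul c).add (a.smul d))
  | mul_smul (c d : K) (a : Pre K V) : Rel K V (a.smul (c * d)) ((a.smul d).smul c)
  | one_smul (a : Pre K V) : Rel K V (a.smul 1) a
  | zero_smul (a : Pre K V) : Rel K V (a.smul 0) Pre.zero
  | of_add (v w : V) : Rel K V (Pre.of (v + w)) ((Pre.of v).add (Pre.of w))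
  | of_smul (c : K) (v : V) : Rel K V (Pre.of (c • v)) ((Pre.of v).smul c)
  | add_dot (a b c : Pre K V) : Rel K V ((a.add b).dot c) ((a.dot c).add (b.dot c))
  | smul_dot (k : K) (a b : Pre K V) : Rel K V ((a.smul k).dot b) ((a.dot b).smul k)
  | dot_add (a b c : Pre K V) : Rel K V (a.dot (b.add c)) ((a.dot b).add (a.dot c))
  | dot_smul (k : K) (a b : Pre K V) : Rel K V (a.dot (b.smul k)) ((a.dot b).smul k)
  | add_circ (a b c : Pre K V) : Rel K V ((a.add b).circ c) ((a.circ c).add (b.circ c))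
  | smul_circ (k : K) (a b : Pre K V) : Rel K V ((a.smul k).circ b) ((a.circ b).smul k)
  | circ_add (a b c : Pre K V) : Rel K V (a.circ (b.add c)) ((a.circ b).add (a.circ c))
  | circ_smul (k : K) (a b : Pre K V) : Rel K V (a.circ (b.smul k)) ((a.circ b).smul k)
  | dot_assoc (a b c : Pre K V) : Rel K V ((a.dot b).dot c) (a.dot (b.dot c))
  | circ_assoc (a b c : Pre K V) : Rel K V ((a.circ b).circ c) (a.circ (b.circ c))
  | star_assoc (a b c : Pre K V) : Rel K V ((a.star b).star c) (a.star (b.star c))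

/-- `Rel` as a setoid. -/
def relSetoid (K : Type*) (V : Type*) [Field K] [AddCommGroup V] [Module K V] :
    Setoid (Pre K V) := ⟨Rel K V, Rel.refl, Rel.symm, Rel.trans⟩

end FreeCompat

/-- The free compatible associative algebra `As²(V)` on the vector space `V`. -/
def FreeCompat (K : Type*) (V : Type*) [Field K] [AddCommGroup V] [Module K V] :=
  Quotient (FreeCompat.relSetoid K V)

namespace FreeCompat

section

variable {K V : Type*} [Field K] [AddCommGroup V] [Module K V]

/-- The class of a formal expression. -/
def mk (a : Pre K V) : FreeCompat K V := Quotient.mk (relSetoid K V) a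

theorem mk_eq {a b : Pre K V} (h : Rel K V a b) : mk a = mk b := Quotient.sound h

theorem mk_surj (x : FreeCompat K V) : ∃ a, mk a = x := Quotient.exists_rep x

instance : Add (FreeCompat K V) :=
  ⟨Quotient.map₂ Pre.add fun _ _ h _ _ h' => Rel.congr_add h h'⟩

instance : Zero (FreeCompat K V) := ⟨mk Pre.zero⟩

instance : Neg (FreeCompat K V) :=
  ⟨Quotient.map (Pre.smul (-1)) fun _ _ h => Rel.congr_smul _ h⟩

instance : AddCommGroup (FreeCompat K V) where
  nsmul := nsmulRec
  zsmul := zsmulRec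
  add_assoc := by
    rintro ⟨a⟩ ⟨b⟩ ⟨c⟩
    exact mk_eq (Rel.add_assoc a b c)
  zero_add := by
    rintro ⟨a⟩
    exact mk_eq (Rel.zero_add a)
  add_zero := by
    rintro ⟨a⟩
    exact mk_eq ((Rel.add_comm _ _).trans (Rel.zero_add a))
  add_comm := by
    rintro ⟨a⟩ ⟨b⟩
    exact mk_eq (Rel.add_comm a b)
  neg_add_cancel := by
    rintro ⟨a⟩
    refine mk_eq (((Rel.congr_add (Rel.refl _) (Rel.one_smul a).symm).trans
      (Rel.add_smul (-1) 1 a).symm).trans ?_)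
    rw [neg_add_cancel]
    exact Rel.zero_smul a

theorem mk_add (a b : Pre K V) : mk (a.add b) = mk a + mk b := rfl

theorem mk_zero : mk (Pre.zero : Pre K V) = 0 := rfl

instance : Module K (FreeCompat K V) where
  smul c := Quotient.map (Pre.smul c) fun _ _ h => Rel.congr_smul _ h
  one_smul := by
    rintro ⟨a⟩
    exact mk_eq (Rel.one_smul a)
  mul_smul := by
    rintro c d ⟨a⟩
    exact mk_eq (Rel.mul_smul c d a)
  smul_zero := by
    intro c
    refine mk_eq (((Rel.congr_smul c (Rel.zero_smul Pre.zero).symm).trans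
      (Rel.mul_smul c 0 Pre.zero).symm).trans ?_)
    rw [mul_zero]
    exact Rel.zero_smul _
  smul_add := by
    rintro c ⟨a⟩ ⟨b⟩
    exact mk_eq (Rel.smul_add c a b)
  add_smul := by
    rintro c d ⟨a⟩
    exact mk_eq (Rel.add_smul c d a)
  zero_smul := by
    rintro ⟨a⟩
    exact mk_eq (Rel.zero_smul a)

theorem mk_smul (c : K) (a : Pre K V) : mk (a.smul c) = c • mk a := rfl

instance : CompatAssocAlgebra K (FreeCompat K V) where
  dot := LinearMap.mk₂ K (Quotient.map₂ Pre.dot fun _ _ h _ _ h' => Rel.congr_dot h h')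
    (by rintro ⟨a⟩ ⟨b⟩ ⟨c⟩; exact mk_eq (Rel.add_dot a b c))
    (by rintro k ⟨a⟩ ⟨b⟩; exact mk_eq (Rel.smul_dot k a b))
    (by rintro ⟨a⟩ ⟨b⟩ ⟨c⟩; exact mk_eq (Rel.dot_add a b c))
    (by rintro k ⟨a⟩ ⟨b⟩; exact mk_eq (Rel.dot_smul k a b))
  circ := LinearMap.mk₂ K (Quotient.map₂ Pre.circ fun _ _ h _ _ h' => Rel.congr_circ h h')
    (by rintro ⟨a⟩ ⟨b⟩ ⟨c⟩; exact mk_eq (Rel.add_circ a b c))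
    (by rintro k ⟨a⟩ ⟨b⟩; exact mk_eq (Rel.smul_circ k a b))
    (by rintro ⟨a⟩ ⟨b⟩ ⟨c⟩; exact mk_eq (Rel.circ_add a b c))
    (by rintro k ⟨a⟩ ⟨b⟩; exact mk_eq (Rel.circ_smul k a b))
  dot_assoc := by
    rintro ⟨a⟩ ⟨b⟩ ⟨c⟩
    exact mk_eq (Rel.dot_assoc a b c)
  circ_assoc := by
    rintro ⟨a⟩ ⟨b⟩ ⟨c⟩
    exact mk_eq (Rel.circ_assoc a b c)
  sum_assoc := by
    rintro ⟨a⟩ ⟨b⟩ ⟨c⟩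
    exact mk_eq (Rel.star_assoc a b c)

open CompatAssocAlgebra

theorem mk_dot (a b : Pre K V) : mk (a.dot b) = dot (K := K) (mk a) (mk b) := rfl

theorem mk_circ (a b : Pre K V) : mk (a.circ b) = circ (K := K) (mk a) (mk b) := rfl

variable (K V) in
/-- The canonical map `V → As²(V)`. -/
def ι : V →ₗ[K] FreeCompat K V where
  toFun v := mk (Pre.of v)
  map_add' v w := mk_eq (Rel.of_add v w)
  map_smul' c v := mk_eq (Rel.of_smul c v)

variable {A : Type*} [AddCommGroup A] [Module K A] [CompatAssocAlgebra K A]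

/-- Evaluation of a formal expression in a compatible associative algebra. -/
def Pre.eval (f : V →ₗ[K] A) : Pre K V → A
  | .of v => f v
  | .zero => 0
  | .add a b => a.eval f + b.eval f
  | .smul c a => c • a.eval f
  | .dot a b => CompatAssocAlgebra.dot (K := K) (a.eval f) (b.eval f)
  | .circ a b => CompatAssocAlgebra.circ (K := K) (a.eval f) (b.eval f)

theorem Pre.eval_rel (f : V →ₗ[K] A) {a b : Pre K V} (h : Rel K V a b) :
    a.eval f = b.eval f := by
  induction h with
  | refl => rfl
  | symm _ ih => exact ih.symm
  | trans _ _ ih ih' => exact ih.trans ih'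
  | congr_add _ _ ih ih' => simp only [Pre.eval, ih, ih']
  | congr_smul _ _ ih => simp only [Pre.eval, ih]
  | congr_dot _ _ ih ih' => simp only [Pre.eval, ih, ih']
  | congr_circ _ _ ih ih' => simp only [Pre.eval, ih, ih']
  | add_assoc => simp only [Pre.eval, add_assoc]
  | add_comm => simp only [Pre.eval, add_comm]
  | mul_smul => simp only [Pre.eval, mul_smul]
  | add_smul => simp only [Pre.eval, add_smul]
  | dot_assoc => simp only [Pre.eval, CompatAssocAlgebra.dot_assoc]
  | circ_assoc => simp only [Pre.eval, CompatAssocAlgebra.circ_assoc]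
  | star_assoc a b c =>
    exact CompatAssocAlgebra.sum_assoc (K := K) (a.eval f) (b.eval f) (c.eval f)
  | _ => simp [Pre.eval]

/-- The morphism `As²(V) → A` induced by a linear map `V → A`. -/
def lift (f : V →ₗ[K] A) : FreeCompat K V →ₗ[K] A where
  toFun := Quotient.lift (Pre.eval f) fun _ _ h => Pre.eval_rel f h
  map_add' := by
    rintro ⟨a⟩ ⟨b⟩
    rfl
  map_smul' := by
    rintro c ⟨a⟩
    rfl

theorem lift_ι (f : V →ₗ[K] A) (v : V) : lift f (ι K V v) = f v := rfl

theorem lift_dot (f : V →ₗ[K] A) (x y : FreeCompat K V) :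
    lift f (dot (K := K) x y) = dot (K := K) (lift f x) (lift f y) := by
  obtain ⟨a, rfl⟩ := mk_surj x
  obtain ⟨b, rfl⟩ := mk_surj y
  rfl

theorem lift_circ (f : V →ₗ[K] A) (x y : FreeCompat K V) :
    lift f (circ (K := K) x y) = circ (K := K) (lift f x) (lift f y) := by
  obtain ⟨a, rfl⟩ := mk_surj x
  obtain ⟨b, rfl⟩ := mk_surj y
  rfl

/-- Elements of `As²(V)` are generated by `V` under linear combinations and both products. -/
theorem induction_on {P : FreeCompat K V → Prop} (x : FreeCompat K V)
    (of : ∀ v, P (ι K V v)) (zero : P 0) (add : ∀ x y, P x → P y → P (x + y))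
    (smul : ∀ (c : K) x, P x → P (c • x))
    (dot : ∀ x y, P x → P y → P (CompatAssocAlgebra.dot (K := K) x y))
    (circ : ∀ x y, P x → P y → P (CompatAssocAlgebra.circ (K := K) x y)) : P x := by
  obtain ⟨a, rfl⟩ := mk_surj x
  induction a with
  | of v => exact of v
  | zero => exact zero
  | add a b iha ihb => exact add _ _ iha ihb
  | smul c a iha => exact smul c _ iha
  | dot a b iha ihb => exact dot _ _ iha ihb
  | circ a b iha ihb => exact circ _ _ iha ihb

/-- Uniqueness part of the universal property of `As²(V)`. -/
theorem lift_unique (f : V →ₗ[K] A) (g : FreeCompat K V →ₗ[K] A)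
    (hι : ∀ v, g (ι K V v) = f v)
    (hdot : ∀ x y, g (dot (K := K) x y) = dot (K := K) (g x) (g y))
    (hcirc : ∀ x y, g (circ (K := K) x y) = circ (K := K) (g x) (g y)) : g = lift f := by
  ext x
  induction x using induction_on with
  | of v => rw [hι, lift_ι]
  | zero => simp
  | add x y hx hy => rw [map_add, map_add, hx, hy]
  | smul c x hx => rw [map_smul, map_smul, hx]
  | dot x y hx hy => rw [hdot, lift_dot, hx, hy]
  | circ x y hx hy => rw [hcirc, lift_circ, hx, hy]

end

end FreeCompat

/-! ## The canonical coproduct on the free compatible associative algebra -/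

section InfinitesimalExtension

variable {K A : Type*} [Field K] [AddCommGroup A] [Module K A]

/-- For a bilinear product `m` on `A`, the bilinear product
`(x, a) (y, b) = (x y, x b + a y + x ⊗ y)` on `A × (A ⊗ A)`,
where `x (u ⊗ v) = (x u) ⊗ v` and `(u ⊗ v) y = u ⊗ (v y)`. A linear map `Δ : A → A ⊗ A` satisfies
the infinitesimal relation for `m` precisely when `x ↦ (x, Δ x)` is multiplicative. -/
def infMul (m : A →ₗ[K] A →ₗ[K] A) :
    (A × (A ⊗[K] A)) →ₗ[K] (A × (A ⊗[K] A)) →ₗ[K] (A × (A ⊗[K] A)) :=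
  LinearMap.mk₂ K
    (fun p q => (m p.1 q.1,
      (m p.1).rTensor A q.2 + (m.flip q.1).lTensor A p.2 + p.1 ⊗ₜ[K] q.1))
    (by
      intro p p' q
      ext
      · simp
      · simp [LinearMap.rTensor_add, TensorProduct.add_tmul]
        abel)
    (by
      intro c p q
      ext <;> simp [LinearMap.rTensor_smul, TensorProduct.smul_tmul'])
    (by
      intro p q q'
      ext
      · simp
      · simp [LinearMap.lTensor_add, TensorProduct.tmul_add]
        abel)
    (by
      intro c p q
      ext <;> simp [LinearMap.lTensor_smul])

theorem infMul_apply (m : A →ₗ[K] A →ₗ[K] A) (p q : A × (A ⊗[K] A)) :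
    infMul m p q = (m p.1 q.1,
      (m p.1).rTensor A q.2 + (m.flip q.1).lTensor A p.2 + p.1 ⊗ₜ[K] q.1) := rfl

/-- The case of a multiple `c` of the term `x ⊗ y`; needed for the sum of two products. -/
theorem infMul_assoc_aux (m : A →ₗ[K] A →ₗ[K] A)
    (h : ∀ x y z, m (m x y) z = m x (m y z)) (c : K) (p q r : A × (A ⊗[K] A)) :
    (m (m p.1 q.1)).rTensor A r.2 +
        (m.flip r.1).lTensor A
          ((m p.1).rTensor A q.2 + (m.flip q.1).lTensor A p.2 + c • p.1 ⊗ₜ[K] q.1) +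
        c • m p.1 q.1 ⊗ₜ[K] r.1 =
      (m p.1).rTensor A
          ((m q.1).rTensor A r.2 + (m.flip r.1).lTensor A q.2 + c • q.1 ⊗ₜ[K] r.1) +
        (m.flip (m q.1 r.1)).lTensor A p.2 + c • p.1 ⊗ₜ[K] m q.1 r.1 := by
  have h1 : m (m p.1 q.1) = m p.1 ∘ₗ m q.1 := by
    ext z
    simp [h]
  have h2 : m.flip (m q.1 r.1) = m.flip r.1 ∘ₗ m.flip q.1 := by
    ext z
    simp [h]
  have h3 : (m p.1).rTensor A ((m.flip r.1).lTensor A q.2) =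
      (m.flip r.1).lTensor A ((m p.1).rTensor A q.2) := by
    rw [← LinearMap.comp_apply, ← LinearMap.comp_apply, LinearMap.rTensor_comp_lTensor,
      LinearMap.lTensor_comp_rTensor]
  rw [h1, h2, LinearMap.rTensor_comp, LinearMap.lTensor_comp]
  simp only [map_add, map_smul, LinearMap.comp_apply, h3, LinearMap.rTensor_tmul,
    LinearMap.lTensor_tmul, LinearMap.flip_apply]
  abel

theorem infMul_assoc (m : A →ₗ[K] A →ₗ[K] A) (h : ∀ x y z, m (m x y) z = m x (m y z))
    (p q r : A × (A ⊗[K] A)) : infMul m (infMul m p q) r = infMul m p (infMul m q r) := by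
  have := infMul_assoc_aux m h 1 p q r
  simp only [one_smul] at this
  simp only [infMul_apply]
  exact Prod.ext (h _ _ _) this

theorem infMul_add_apply (m m' : A →ₗ[K] A →ₗ[K] A) (p q : A × (A ⊗[K] A)) :
    (infMul m + infMul m') p q = ((m + m') p.1 q.1,
      ((m + m') p.1).rTensor A q.2 + ((m + m').flip q.1).lTensor A p.2 +
        (2 : K) • p.1 ⊗ₜ[K] q.1) := by
  have hf : (m + m').flip q.1 = m.flip q.1 + m'.flip q.1 := by
    ext
    simp
  ext
  · simp [infMul_apply]
  · simp only [LinearMap.add_apply, infMul_apply, Prod.snd_add, hf, LinearMap.rTensor_add,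
      LinearMap.lTensor_add, two_smul]
    abel

theorem infMul_add_assoc (m m' : A →ₗ[K] A →ₗ[K] A)
    (h : ∀ x y z, (m + m') ((m + m') x y) z = (m + m') x ((m + m') y z))
    (p q r : A × (A ⊗[K] A)) :
    (infMul m + infMul m') ((infMul m + infMul m') p q) r =
      (infMul m + infMul m') p ((infMul m + infMul m') q r) := by
  simp only [infMul_add_apply]
  exact Prod.ext (h _ _ _) (infMul_assoc_aux (m + m') h 2 p q r)

/-- The compatible associative algebra structure on `A × (A ⊗ A)` given by `infMul`. -/
abbrev infExtension (K A : Type*) [Field K] [AddCommGroup A] [Module K A]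
    [CompatAssocAlgebra K A] : CompatAssocAlgebra K (A × (A ⊗[K] A)) where
  dot := infMul CompatAssocAlgebra.dot
  circ := infMul CompatAssocAlgebra.circ
  dot_assoc := infMul_assoc _ CompatAssocAlgebra.dot_assoc
  circ_assoc := infMul_assoc _ CompatAssocAlgebra.circ_assoc
  sum_assoc := infMul_add_assoc _ _ CompatAssocAlgebra.sum_assoc

end InfinitesimalExtension

namespace FreeCompat

section

open CompatAssocAlgebra

variable {K V : Type*} [Field K] [AddCommGroup V] [Module K V]

variable (K V) in
/-- The map `x ↦ (x, Δ x)`: the morphism of compatible associative algebras extending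
`v ↦ (v, 0)`. -/
def comulGraph : FreeCompat K V →ₗ[K] FreeCompat K V × (FreeCompat K V ⊗[K] FreeCompat K V) :=
  letI := infExtension K (FreeCompat K V)
  lift (LinearMap.inl K (FreeCompat K V) (FreeCompat K V ⊗[K] FreeCompat K V) ∘ₗ ι K V)

variable (K V) in
/-- The canonical coproduct on `As²(V)`. It is the unique linear map that vanishes on `V` and
satisfies the infinitesimal relation for both products: see `comul_ι`, `comul_dot`,
`comul_circ` and `comul_unique`. -/
def comul : FreeCompat K V →ₗ[K] FreeCompat K V ⊗[K] FreeCompat K V :=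
  LinearMap.snd K _ _ ∘ₗ comulGraph K V

theorem comulGraph_ι (v : V) : comulGraph K V (ι K V v) = (ι K V v, 0) := rfl

theorem comulGraph_dot (x y : FreeCompat K V) : comulGraph K V (dot (K := K) x y) =
    infMul (dot (K := K)) (comulGraph K V x) (comulGraph K V y) :=
  letI := infExtension K (FreeCompat K V)
  lift_dot (LinearMap.inl K (FreeCompat K V) (FreeCompat K V ⊗[K] FreeCompat K V) ∘ₗ ι K V) x y

theorem comulGraph_circ (x y : FreeCompat K V) : comulGraph K V (circ (K := K) x y) =
    infMul (circ (K := K)) (comulGraph K V x) (comulGraph K V y) :=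
  letI := infExtension K (FreeCompat K V)
  lift_circ (LinearMap.inl K (FreeCompat K V) (FreeCompat K V ⊗[K] FreeCompat K V) ∘ₗ ι K V) x y

theorem comulGraph_fst (x : FreeCompat K V) : (comulGraph K V x).1 = x := by
  induction x using induction_on with
  | of v => rfl
  | zero => simp
  | add x y hx hy => rw [map_add, Prod.fst_add, hx, hy]
  | smul c x hx => rw [map_smul, Prod.smul_fst, hx]
  | dot x y hx hy => rw [comulGraph_dot, infMul_apply, hx, hy]
  | circ x y hx hy => rw [comulGraph_circ, infMul_apply, hx, hy]

theorem comul_ι (v : V) : comul K V (ι K V v) = 0 := rfl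

/-- `Δ(x · y) = x₁ ⊗ (x₂ · y) + (x · y₁) ⊗ y₂ + x ⊗ y`. -/
theorem comul_dot (x y : FreeCompat K V) : comul K V (dot (K := K) x y) =
    (dot.flip y).lTensor _ (comul K V x) + (dot x).rTensor _ (comul K V y) + x ⊗ₜ[K] y := by
  change (comulGraph K V _).2 = (dot.flip y).lTensor _ (comulGraph K V x).2 +
    (dot x).rTensor _ (comulGraph K V y).2 + x ⊗ₜ[K] y
  rw [comulGraph_dot, infMul_apply, comulGraph_fst, comulGraph_fst]
  simp only
  abel

/-- `Δ(x ∘ y) = x₁ ⊗ (x₂ ∘ y) + (x ∘ y₁) ⊗ y₂ + x ⊗ y`. -/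
theorem comul_circ (x y : FreeCompat K V) : comul K V (circ (K := K) x y) =
    (circ.flip y).lTensor _ (comul K V x) + (circ x).rTensor _ (comul K V y) + x ⊗ₜ[K] y := by
  change (comulGraph K V _).2 = (circ.flip y).lTensor _ (comulGraph K V x).2 +
    (circ x).rTensor _ (comulGraph K V y).2 + x ⊗ₜ[K] y
  rw [comulGraph_circ, infMul_apply, comulGraph_fst, comulGraph_fst]
  simp only
  abel

theorem comul_unique (D : FreeCompat K V →ₗ[K] FreeCompat K V ⊗[K] FreeCompat K V)
    (hι : ∀ v, D (ι K V v) = 0)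
    (hdot : ∀ x y, D (dot (K := K) x y) =
      (dot.flip y).lTensor _ (D x) + (dot x).rTensor _ (D y) + x ⊗ₜ[K] y)
    (hcirc : ∀ x y, D (circ (K := K) x y) =
      (circ.flip y).lTensor _ (D x) + (circ x).rTensor _ (D y) + x ⊗ₜ[K] y) :
    D = comul K V := by
  ext x
  induction x using induction_on with
  | of v => rw [hι, comul_ι]
  | zero => simp
  | add x y hx hy => rw [map_add, map_add, hx, hy]
  | smul c x hx => rw [map_smul, map_smul, hx]
  | dot x y hx hy => rw [hdot, comul_dot, hx, hy]
  | circ x y hx hy => rw [hcirc, comul_circ, hx, hy]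

end

end FreeCompat

/-! ## `𝒩`-algebras -/

/-- A family of operations, `N n` having arity `n + 2`, as a function on lists of length at
least two: `onList N [x₁, …, xₘ]` is the value of the `m`-ary operation at `(x₁, …, xₘ)`.
On lists of length zero or one, where there is no operation, it is set to `0`. -/
def onList {A : Type*} [Zero A] (N : ∀ n : ℕ, (Fin (n + 2) → A) → A) : List A → A
  | a :: b :: l => N l.length (fun i => (a :: b :: l).get i)
  | _ => 0

theorem onList_eq {A : Type*} [Zero A] (N : ∀ n : ℕ, (Fin (n + 2) → A) → A) (n : ℕ)
    (l : List A) (h : n + 2 = l.length) : onList N l = N n (fun i => l.get (i.cast h)) := by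
  match l, h with
  | a :: b :: l, h =>
    obtain rfl : n = l.length := by simpa using h
    rfl

theorem onList_ofFn {A : Type*} [Zero A] (N : ∀ n : ℕ, (Fin (n + 2) → A) → A) (n : ℕ)
    (x : Fin (n + 2) → A) : onList N (List.ofFn x) = N n x := by
  rw [onList_eq N n _ (by simp)]
  congr 1
  ext i
  rw [List.get_ofFn]
  rfl

theorem map_onList {A B : Type*} [Zero A] [Zero B] (N : ∀ n : ℕ, (Fin (n + 2) → A) → A)
    (M : ∀ n : ℕ, (Fin (n + 2) → B) → B) (φ : A → B) (h0 : φ 0 = 0)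
    (h : ∀ n x, φ (N n x) = M n (fun i => φ (x i))) (l : List A) :
    φ (onList N l) = onList M (l.map φ) := by
  match l with
  | [] => exact h0
  | [a] => exact h0
  | a :: b :: l =>
    rw [onList_eq M l.length _ (by simp), onList_eq N l.length _ (by simp), h]
    congr 1
    ext i
    exact List.getElem_map_rev φ (l := a :: b :: l) (n := i) (h := i.isLt)

/-- The relations of an `𝒩`-algebra; `N [x₁, …, xₙ]` stands for `Nₙ(x₁, …, xₙ)`. -/
structure NRelations {A : Type*} [AddCommGroup A] (N : List A → A) : Prop where
  /-- `l = [x₁, …, xₙ₋₁]`, `a = xₙ`, `b = xₙ₊₁` with `n ≥ 2`; the summation index is `j = i - 1`. -/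
  rel_one : ∀ (l : List A) (a b : A), 1 ≤ l.length →
    N (l ++ [N [a, b]]) =
      ∑ j ∈ Finset.range l.length, N (l.take j ++ [N (l.drop j ++ [a]), b])
  /-- `a = x₁`, `b = x₂`, `l = [x₃, …, xₙ]`, `c = xₙ₊₁` with `n ≥ 3`; the summation index is
  `j = n - i`. -/
  rel_two : ∀ (a b : A) (l : List A) (c : A), 1 ≤ l.length →
    N [a, N (b :: l ++ [c])] = N (N [a, b] :: l ++ [c]) -
      ∑ j ∈ Finset.range l.length,
        N (a :: N (b :: l.take (j + 1)) :: l.drop (j + 1) ++ [c])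
  /-- `y = [y₁, …, yₙ₋₂]`, `t = [t₁, …, tᵣ₋₂]` with `n, r ≥ 3`; the summation index is
  `j = i - 1`. -/
  rel_three : ∀ (x : A) (y : List A) (z : A) (t : List A) (w : A),
    1 ≤ y.length → 1 ≤ t.length →
    N (x :: y ++ [N (z :: t ++ [w])]) = N (N (x :: y ++ [z]) :: t ++ [w]) +
      ∑ j ∈ Finset.range y.length,
        N (x :: y.take j ++ N (y.drop j ++ [z]) :: t ++ [w]) -
      ∑ j ∈ Finset.range t.length,
        N (x :: y ++ N (z :: t.take (j + 1)) :: t.drop (j + 1) ++ [w])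

/-- An `𝒩`-algebra over `K`: a vector space with an `m`-linear operation for every `m ≥ 2`
(`op n` is the operation of arity `m = n + 2`) satisfying `NRelations`. -/
class NAlgebra (K : Type*) (A : Type*) [Field K] [AddCommGroup A] [Module K A] where
  op : ∀ n : ℕ, MultilinearMap K (fun _ : Fin (n + 2) => A) A
  relations : NRelations (onList fun n => op n)

/-! ## The free `𝒩`-algebra -/

namespace FreeN

/-- Formal expressions in elements of `V`, linear combinations and operations of every
arity `n + 2`. -/
inductive Pre (K : Type*) (V : Type*) where
  | of : V → Pre K V
  | zero : Pre K V
  | add : Pre K V → Pre K V → Pre K V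
  | smul : K → Pre K V → Pre K V
  | op : (n : ℕ) → (Fin (n + 2) → Pre K V) → Pre K V

instance {K V : Type*} : Zero (Pre K V) := ⟨Pre.zero⟩

instance {K V : Type*} : Add (Pre K V) := ⟨Pre.add⟩

instance {K V : Type*} : SMul K (Pre K V) := ⟨Pre.smul⟩

/-- The formal operation applied to a list. -/
def Pre.N {K V : Type*} (l : List (Pre K V)) : Pre K V := onList Pre.op l

/-- The formal sum `f 0 + ⋯ + f (n - 1)`. -/
def Pre.sum {K V : Type*} (n : ℕ) (f : ℕ → Pre K V) : Pre K V := ((List.range n).map f).sum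

/-- The congruence generated by the axioms of vector spaces, linearity of `V → 𝒩(V)`,
multilinearity of the operations, and the relations of an `𝒩`-algebra. -/
inductive Rel (K : Type*) (V : Type*) [Field K] [AddCommGroup V] [Module K V] :
    Pre K V → Pre K V → Prop where
  | refl (a : Pre K V) : Rel K V a a
  | symm {a b : Pre K V} : Rel K V a b → Rel K V b a
  | trans {a b c : Pre K V} : Rel K V a b → Rel K V b c → Rel K V a c
  | congr_add {a a' b b' : Pre K V} : Rel K V a a' → Rel K V b b' → Rel K V (a + b) (a' + b')
  | congr_smul (c : K) {a a' : Pre K V} : Rel K V a a' → Rel K V (c • a) (c • a')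
  | congr_op (n : ℕ) {x x' : Fin (n + 2) → Pre K V} : (∀ i, Rel K V (x i) (x' i)) →
      Rel K V (Pre.op n x) (Pre.op n x')
  | add_assoc (a b c : Pre K V) : Rel K V (a + b + c) (a + (b + c))
  | add_comm (a b : Pre K V) : Rel K V (a + b) (b + a)
  | zero_add (a : Pre K V) : Rel K V (0 + a) a
  | smul_add (c : K) (a b : Pre K V) : Rel K V (c • (a + b)) (c • a + c • b)
  | add_smul (c d : K) (a : Pre K V) : Rel K V ((c + d) • a) (c • a + d • a)
  | mul_smul (c d : K) (a : Pre K V) : Rel K V ((c * d) • a) (c • d • a)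
  | one_smul (a : Pre K V) : Rel K V ((1 : K) • a) a
  | zero_smul (a : Pre K V) : Rel K V ((0 : K) • a) 0
  | of_add (v w : V) : Rel K V (Pre.of (v + w)) (Pre.of v + Pre.of w)
  | of_smul (c : K) (v : V) : Rel K V (Pre.of (c • v)) (c • Pre.of v)
  | op_add (n : ℕ) (x : Fin (n + 2) → Pre K V) (i : Fin (n + 2)) (a b : Pre K V) :
      Rel K V (Pre.op n (Function.update x i (a + b)))
        (Pre.op n (Function.update x i a) + Pre.op n (Function.update x i b))
  | op_smul (n : ℕ) (x : Fin (n + 2) → Pre K V) (i) (c : K) (a : Pre K V) :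
      Rel K V (Pre.op n (Function.update x i (c • a))) (c • Pre.op n (Function.update x i a))
  | rel_one (l : List (Pre K V)) (a b : Pre K V) : 1 ≤ l.length →
      Rel K V (Pre.N (l ++ [Pre.N [a, b]]))
        (Pre.sum l.length fun j => Pre.N (l.take j ++ [Pre.N (l.drop j ++ [a]), b]))
  | rel_two (a b : Pre K V) (l : List (Pre K V)) (c : Pre K V) : 1 ≤ l.length →
      Rel K V (Pre.N [a, Pre.N (b :: l ++ [c])])
        (Pre.N (Pre.N [a, b] :: l ++ [c]) +
          (-1 : K) • Pre.sum l.length fun j =>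
            Pre.N (a :: Pre.N (b :: l.take (j + 1)) :: l.drop (j + 1) ++ [c]))
  | rel_three (x : Pre K V) (y : List (Pre K V)) (z : Pre K V) (t : List (Pre K V))
      (w : Pre K V) : 1 ≤ y.length → 1 ≤ t.length →
      Rel K V (Pre.N (x :: y ++ [Pre.N (z :: t ++ [w])]))
        (Pre.N (Pre.N (x :: y ++ [z]) :: t ++ [w]) +
          (Pre.sum y.length fun j =>
            Pre.N (x :: y.take j ++ Pre.N (y.drop j ++ [z]) :: t ++ [w])) +
          (-1 : K) • Pre.sum t.length fun j =>
            Pre.N (x :: y ++ Pre.N (z :: t.take (j + 1)) :: t.drop (j + 1) ++ [w]))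

/-- `Rel` as a setoid. -/
def relSetoid (K : Type*) (V : Type*) [Field K] [AddCommGroup V] [Module K V] :
    Setoid (Pre K V) := ⟨Rel K V, Rel.refl, Rel.symm, Rel.trans⟩

end FreeN

/-- The free `𝒩`-algebra `𝒩(V)` on the vector space `V`. -/
def FreeN (K : Type*) (V : Type*) [Field K] [AddCommGroup V] [Module K V] :=
  Quotient (FreeN.relSetoid K V)

namespace FreeN

section

variable {K V : Type*} [Field K] [AddCommGroup V] [Module K V]

/-- The class of a formal expression. -/
def mk (a : Pre K V) : FreeN K V := Quotient.mk (relSetoid K V) a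

theorem mk_eq {a b : Pre K V} (h : Rel K V a b) : mk a = mk b := Quotient.sound h

theorem mk_surj (x : FreeN K V) : ∃ a, mk a = x := Quotient.exists_rep x

theorem rel_of_mk_eq {a b : Pre K V} (h : mk a = mk b) : Rel K V a b := Quotient.exact h

instance : Add (FreeN K V) :=
  ⟨Quotient.map₂ (fun a b => a + b) fun _ _ h _ _ h' => Rel.congr_add h h'⟩

instance : Zero (FreeN K V) := ⟨mk 0⟩

instance : Neg (FreeN K V) :=
  ⟨Quotient.map (fun a => (-1 : K) • a) fun _ _ h => Rel.congr_smul _ h⟩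

instance : AddCommGroup (FreeN K V) where
  nsmul := nsmulRec
  zsmul := zsmulRec
  add_assoc := by
    rintro ⟨a⟩ ⟨b⟩ ⟨c⟩
    exact mk_eq (Rel.add_assoc a b c)
  zero_add := by
    rintro ⟨a⟩
    exact mk_eq (Rel.zero_add a)
  add_zero := by
    rintro ⟨a⟩
    exact mk_eq ((Rel.add_comm _ _).trans (Rel.zero_add a))
  add_comm := by
    rintro ⟨a⟩ ⟨b⟩
    exact mk_eq (Rel.add_comm a b)
  neg_add_cancel := by
    rintro ⟨a⟩
    refine mk_eq (((Rel.congr_add (Rel.refl _) (Rel.one_smul a).symm).trans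
      (Rel.add_smul (-1) 1 a).symm).trans ?_)
    rw [neg_add_cancel]
    exact Rel.zero_smul a

theorem mk_add (a b : Pre K V) : mk (a + b) = mk a + mk b := rfl

theorem mk_zero : mk (0 : Pre K V) = 0 := rfl

instance : Module K (FreeN K V) where
  smul c := Quotient.map (fun a => c • a) fun _ _ h => Rel.congr_smul _ h
  one_smul := by
    rintro ⟨a⟩
    exact mk_eq (Rel.one_smul a)
  mul_smul := by
    rintro c d ⟨a⟩
    exact mk_eq (Rel.mul_smul c d a)
  smul_zero := by
    intro c
    refine mk_eq (((Rel.congr_smul c (Rel.zero_smul 0).symm).trans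
      (Rel.mul_smul c 0 0).symm).trans ?_)
    rw [mul_zero]
    exact Rel.zero_smul _
  smul_add := by
    rintro c ⟨a⟩ ⟨b⟩
    exact mk_eq (Rel.smul_add c a b)
  add_smul := by
    rintro c d ⟨a⟩
    exact mk_eq (Rel.add_smul c d a)
  zero_smul := by
    rintro ⟨a⟩
    exact mk_eq (Rel.zero_smul a)

theorem mk_smul (c : K) (a : Pre K V) : mk (c • a) = c • mk a := rfl

theorem mk_neg (a : Pre K V) : mk ((-1 : K) • a) = -mk a := rfl

theorem mk_sum (n : ℕ) (f : ℕ → Pre K V) :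
    mk (Pre.sum n f) = ∑ j ∈ Finset.range n, mk (f j) := by
  have key : ∀ L : List ℕ, mk ((L.map f).sum) = (L.map fun j => mk (f j)).sum := by
    intro L
    induction L with
    | nil => rfl
    | cons j L ih => rw [List.map_cons, List.map_cons, List.sum_cons, List.sum_cons, mk_add, ih]
  rw [Pre.sum, key]
  simp [Finset.sum, Finset.range, Multiset.range]

/-- The operations on classes, as functions. -/
def opFun (n : ℕ) (x : Fin (n + 2) → FreeN K V) : FreeN K V :=
  mk (Pre.op n fun i => Quotient.out (x i))

theorem mk_op (n : ℕ) (x : Fin (n + 2) → Pre K V) :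
    mk (Pre.op n x) = opFun n (fun i => mk (x i)) :=
  mk_eq (Rel.congr_op n fun i => rel_of_mk_eq (Quotient.out_eq (mk (x i))).symm)

theorem mk_update {n : ℕ} (x : Fin n → Pre K V) (i : Fin n) (a : Pre K V) :
    (fun j => mk (Function.update x i a j)) = Function.update (fun j => mk (x j)) i (mk a) := by
  ext j
  by_cases h : j = i
  · subst h
    simp
  · simp [h]

/-- The operations on classes. -/
def opMap (n : ℕ) : MultilinearMap K (fun _ : Fin (n + 2) => FreeN K V) (FreeN K V) where
  toFun := opFun n
  map_update_add' := by
    intro inst x i a b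
    obtain rfl : inst = instDecidableEqFin (n + 2) := Subsingleton.elim _ _
    obtain ⟨x, rfl⟩ : ∃ x' : Fin (n + 2) → Pre K V, (fun j => mk (x' j)) = x :=
      ⟨fun j => (x j).out, funext fun j => Quotient.out_eq (x j)⟩
    obtain ⟨a, rfl⟩ := mk_surj a
    obtain ⟨b, rfl⟩ := mk_surj b
    rw [← mk_add, ← mk_update, ← mk_update, ← mk_update, ← mk_op, ← mk_op, ← mk_op]
    exact mk_eq (Rel.op_add n x i a b)
  map_update_smul' := by
    intro inst x i c a
    obtain rfl : inst = instDecidableEqFin (n + 2) := Subsingleton.elim _ _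
    obtain ⟨x, rfl⟩ : ∃ x' : Fin (n + 2) → Pre K V, (fun j => mk (x' j)) = x :=
      ⟨fun j => (x j).out, funext fun j => Quotient.out_eq (x j)⟩
    obtain ⟨a, rfl⟩ := mk_surj a
    rw [← mk_smul, ← mk_update, ← mk_update, ← mk_op, ← mk_op]
    exact mk_eq (Rel.op_smul n x i c a)

theorem mk_N (l : List (Pre K V)) :
    mk (Pre.N l) = onList (fun n => opMap (K := K) (V := V) n) (l.map mk) :=
  map_onList _ _ mk rfl mk_op l

theorem exists_list (l : List (FreeN K V)) : ∃ l' : List (Pre K V), l'.map mk = l :=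
  List.map_surjective_iff.mpr mk_surj l

instance : NAlgebra K (FreeN K V) where
  op := opMap
  relations := by
    constructor
    · intro l a b h
      obtain ⟨l, rfl⟩ := exists_list l
      obtain ⟨a, rfl⟩ := mk_surj a
      obtain ⟨b, rfl⟩ := mk_surj b
      rw [List.length_map] at h
      have := mk_eq (Rel.rel_one l a b h)
      simpa only [mk_sum, mk_N, List.map_append, List.map_cons, List.map_nil, List.map_take,
        List.map_drop, List.length_map] using this
    · intro a b l c h
      obtain ⟨l, rfl⟩ := exists_list l
      obtain ⟨a, rfl⟩ := mk_surj a
      obtain ⟨b, rfl⟩ := mk_surj b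
      obtain ⟨c, rfl⟩ := mk_surj c
      rw [List.length_map] at h
      have := mk_eq (Rel.rel_two a b l c h)
      simpa only [mk_add, mk_neg, mk_sum, mk_N, List.map_append, List.map_cons, List.map_nil,
        List.map_take, List.map_drop, List.length_map, sub_eq_add_neg] using this
    · intro x y z t w hy ht
      obtain ⟨y, rfl⟩ := exists_list y
      obtain ⟨t, rfl⟩ := exists_list t
      obtain ⟨x, rfl⟩ := mk_surj x
      obtain ⟨z, rfl⟩ := mk_surj z
      obtain ⟨w, rfl⟩ := mk_surj w
      rw [List.length_map] at hy ht
      have := mk_eq (Rel.rel_three x y z t w hy ht)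
      simpa only [mk_add, mk_neg, mk_sum, mk_N, List.map_append, List.map_cons, List.map_nil,
        List.map_take, List.map_drop, List.length_map, sub_eq_add_neg] using this

variable (K V) in
/-- The canonical map `V → 𝒩(V)`. -/
def ι : V →ₗ[K] FreeN K V where
  toFun v := mk (Pre.of v)
  map_add' v w := mk_eq (Rel.of_add v w)
  map_smul' c v := mk_eq (Rel.of_smul c v)

/-- Elements of `𝒩(V)` are generated by `V` under linear combinations and the operations. -/
theorem induction_on {P : FreeN K V → Prop} (x : FreeN K V)
    (of : ∀ v, P (ι K V v)) (zero : P 0) (add : ∀ x y, P x → P y → P (x + y))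
    (smul : ∀ (c : K) x, P x → P (c • x))
    (op : ∀ n x, (∀ i, P (x i)) → P (NAlgebra.op (K := K) n x)) : P x := by
  obtain ⟨a, rfl⟩ := mk_surj x
  induction a with
  | of v => exact of v
  | zero => exact zero
  | add a b iha ihb => exact add _ _ iha ihb
  | smul c a iha => exact smul c _ iha
  | op n x ih =>
    rw [mk_op]
    exact op n _ ih

variable {A : Type*} [AddCommGroup A] [Module K A] [NAlgebra K A]

/-- Evaluation of a formal expression in an `𝒩`-algebra. -/
def Pre.eval (f : V →ₗ[K] A) : Pre K V → A
  | .of v => f v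
  | .zero => 0
  | .add a b => a.eval f + b.eval f
  | .smul c a => c • a.eval f
  | .op n x => NAlgebra.op (K := K) n (fun i => (x i).eval f)

theorem Pre.eval_zero (f : V →ₗ[K] A) : Pre.eval f 0 = 0 := rfl

theorem Pre.eval_add (f : V →ₗ[K] A) (a b : Pre K V) :
    Pre.eval f (a + b) = a.eval f + b.eval f := rfl

theorem Pre.eval_smul (f : V →ₗ[K] A) (c : K) (a : Pre K V) :
    Pre.eval f (c • a) = c • a.eval f := rfl

theorem Pre.eval_op (f : V →ₗ[K] A) (n : ℕ) (x : Fin (n + 2) → Pre K V) :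
    Pre.eval f (Pre.op n x) = NAlgebra.op (K := K) n (fun i => (x i).eval f) := rfl

theorem Pre.eval_N (f : V →ₗ[K] A) (l : List (Pre K V)) :
    (Pre.N l).eval f = onList (fun n => NAlgebra.op (K := K) (A := A) n) (l.map (Pre.eval f)) :=
  map_onList _ _ (Pre.eval f) rfl (Pre.eval_op f) l

theorem Pre.eval_sum (f : V →ₗ[K] A) (n : ℕ) (g : ℕ → Pre K V) :
    (Pre.sum n g).eval f = ∑ j ∈ Finset.range n, (g j).eval f := by
  have key : ∀ L : List ℕ, Pre.eval f ((L.map g).sum) = (L.map fun j => (g j).eval f).sum := by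
    intro L
    induction L with
    | nil => rfl
    | cons j L ih =>
      rw [List.map_cons, List.map_cons, List.sum_cons, List.sum_cons, Pre.eval_add, ih]
  rw [Pre.sum, key]
  simp [Finset.sum, Finset.range, Multiset.range]

theorem Pre.eval_update (f : V →ₗ[K] A) {n : ℕ} (x : Fin n → Pre K V) (i : Fin n)
    (a : Pre K V) : (fun j => (Function.update x i a j).eval f) =
      Function.update (fun j => (x j).eval f) i (a.eval f) := by
  ext j
  by_cases h : j = i
  · subst h
    simp
  · simp [h]

theorem Pre.eval_rel (f : V →ₗ[K] A) {a b : Pre K V} (h : Rel K V a b) :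
    a.eval f = b.eval f := by
  have R := NAlgebra.relations (K := K) (A := A)
  induction h with
  | refl => rfl
  | symm _ ih => exact ih.symm
  | trans _ _ ih ih' => exact ih.trans ih'
  | congr_add _ _ ih ih' => simp only [Pre.eval_add, ih, ih']
  | congr_smul _ _ ih => simp only [Pre.eval_smul, ih]
  | congr_op n _ ih => simp only [Pre.eval_op, ih]
  | add_assoc => simp only [Pre.eval_add, add_assoc]
  | add_comm => simp only [Pre.eval_add, add_comm]
  | zero_add => simp only [Pre.eval_add, Pre.eval_zero, zero_add]
  | smul_add => simp only [Pre.eval_add, Pre.eval_smul, smul_add]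
  | add_smul => simp only [Pre.eval_add, Pre.eval_smul, add_smul]
  | mul_smul => simp only [Pre.eval_smul, mul_smul]
  | one_smul => simp only [Pre.eval_smul, one_smul]
  | zero_smul => simp only [Pre.eval_smul, Pre.eval_zero, zero_smul]
  | of_add v w => exact map_add f v w
  | of_smul c v => exact map_smul f c v
  | op_add n x i a b =>
    simp only [Pre.eval_add, Pre.eval_op, Pre.eval_update, MultilinearMap.map_update_add]
  | op_smul n x i c a =>
    simp only [Pre.eval_smul, Pre.eval_op, Pre.eval_update, MultilinearMap.map_update_smul]
  | rel_one l a b h =>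
    have := R.rel_one (l.map (Pre.eval f)) (a.eval f) (b.eval f) (by simpa using h)
    simpa only [Pre.eval_sum, Pre.eval_N, List.map_append, List.map_cons, List.map_nil,
      List.map_take, List.map_drop, List.length_map] using this
  | rel_two a b l c h =>
    have := R.rel_two (a.eval f) (b.eval f) (l.map (Pre.eval f)) (c.eval f) (by simpa using h)
    simpa only [Pre.eval_add, Pre.eval_smul, Pre.eval_sum, Pre.eval_N, List.map_append,
      List.map_cons, List.map_nil, List.map_take, List.map_drop, List.length_map, neg_smul,
      one_smul, sub_eq_add_neg] using this
  | rel_three x y z t w hy ht =>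
    have := R.rel_three (x.eval f) (y.map (Pre.eval f)) (z.eval f) (t.map (Pre.eval f))
      (w.eval f) (by simpa using hy) (by simpa using ht)
    simpa only [Pre.eval_add, Pre.eval_smul, Pre.eval_sum, Pre.eval_N, List.map_append,
      List.map_cons, List.map_nil, List.map_take, List.map_drop, List.length_map, neg_smul,
      one_smul, sub_eq_add_neg] using this

/-- The morphism `𝒩(V) → A` induced by a linear map `V → A`. -/
def lift (f : V →ₗ[K] A) : FreeN K V →ₗ[K] A where
  toFun := Quotient.lift (Pre.eval f) fun _ _ h => Pre.eval_rel f h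
  map_add' := by
    rintro ⟨a⟩ ⟨b⟩
    rfl
  map_smul' := by
    rintro c ⟨a⟩
    rfl

theorem lift_ι (f : V →ₗ[K] A) (v : V) : lift f (ι K V v) = f v := rfl

theorem lift_op (f : V →ₗ[K] A) (n : ℕ) (x : Fin (n + 2) → FreeN K V) :
    lift f (NAlgebra.op (K := K) n x) = NAlgebra.op (K := K) n (fun i => lift f (x i)) := by
  obtain ⟨x, rfl⟩ : ∃ x' : Fin (n + 2) → Pre K V, (fun j => mk (x' j)) = x :=
    ⟨fun j => (x j).out, funext fun j => Quotient.out_eq (x j)⟩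
  exact (congrArg (lift f) (mk_op n x).symm).trans rfl

/-- Uniqueness part of the universal property of `𝒩(V)`. -/
theorem lift_unique (f : V →ₗ[K] A) (g : FreeN K V →ₗ[K] A)
    (hι : ∀ v, g (ι K V v) = f v)
    (hop : ∀ n x, g (NAlgebra.op (K := K) n x) = NAlgebra.op (K := K) n (fun i => g (x i))) :
    g = lift f := by
  ext x
  induction x using induction_on with
  | of v => rw [hι, lift_ι]
  | zero => simp
  | add x y hx hy => rw [map_add, map_add, hx, hy]
  | smul c x hx => rw [map_smul, map_smul, hx]
  | op n x hx => simp only [hop, lift_op, hx]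

end

end FreeN

/-! ## The cofree conilpotent coalgebra -/

/-- The underlying space `⨁_{n ≥ 1} W^{⊗ n}` of the (non-counital) cofree conilpotent coassociative
coalgebra `Tᶜ(W)`; the summand with index `n` is `W^{⊗ (n + 1)}`. -/
abbrev TensorCoalg (K : Type*) (W : Type*) [Field K] [AddCommGroup W] [Module K W] :=
  DirectSum ℕ fun n => ⨂[K] _ : Fin (n + 1), W

namespace TensorCoalg

section

variable (K : Type*) (W : Type*) [Field K] [AddCommGroup W] [Module K W]

/-- The word `w₀ ⊗ ⋯ ⊗ wₙ` in `Tᶜ(W)`, as a multilinear map. -/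
def word (n : ℕ) : MultilinearMap K (fun _ : Fin (n + 1) => W) (TensorCoalg K W) :=
  (DirectSum.lof K ℕ (fun n => ⨂[K] _ : Fin (n + 1), W) n).compMultilinearMap
    (PiTensorProduct.tprod K)

/-- Splitting `n + 1` positions into the first `i + 1` ones and the remaining ones. -/
def cutEquiv (n : ℕ) (i : Fin n) : Fin (i + 1) ⊕ Fin (n - 1 - i + 1) ≃ Fin (n + 1) :=
  finSumFinEquiv.trans (finCongr (by omega))

/-- The multilinear map `(w₀, …, wₙ) ↦ (w₀ ⊗ ⋯ ⊗ wᵢ) ⊗ (wᵢ₊₁ ⊗ ⋯ ⊗ wₙ)`. -/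
def cut (n : ℕ) (i : Fin n) :
    MultilinearMap K (fun _ : Fin (n + 1) => W) (TensorCoalg K W ⊗[K] TensorCoalg K W) :=
  ((word K W i).domCoprod (word K W (n - 1 - i))).domDomCongr (cutEquiv n i)

/-- The deconcatenation coproduct
`w₀ ⊗ ⋯ ⊗ wₙ ↦ ∑ᵢ (w₀ ⊗ ⋯ ⊗ wᵢ) ⊗ (wᵢ₊₁ ⊗ ⋯ ⊗ wₙ)`, the sum being over `0 ≤ i < n`. -/
def comul : TensorCoalg K W →ₗ[K] TensorCoalg K W ⊗[K] TensorCoalg K W :=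
  DirectSum.toModule K ℕ _ fun n => PiTensorProduct.lift (∑ i : Fin n, cut K W n i)

theorem comul_word (n : ℕ) (w : Fin (n + 1) → W) :
    comul K W (word K W n w) = ∑ i : Fin n,
      word K W i (fun j => w ⟨j, by omega⟩) ⊗ₜ[K]
        word K W (n - 1 - i) (fun j => w ⟨i + 1 + j, by omega⟩) := by
  simp only [comul, word, LinearMap.compMultilinearMap_apply, DirectSum.toModule_lof,
    PiTensorProduct.lift.tprod, sum_apply]
  rfl

end

end TensorCoalg

end

/-!
Let `d = ∘ - ·` be the difference of the two products of a compatible associative algebra. The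
three associativity conditions say that `·` is associative, that `d` is a Hochschild two-cocycle
for `·`, that is `d(x y, z) + d(x, y) z = d(x, y z) + x d(y, z)`, and that `d` is associative.

The operations `N(x, z) = d(x, z)` and `N(x, y₁, …, yₖ, z) = d(x, y₁ ⋯ yₖ z) - d(x, y₁ ⋯ yₖ) z`
make *every* compatible associative algebra an `𝒩`-algebra. Indeed the relations of an
`𝒩`-algebra are the cases of a single relation for words `X`, `Z` and a letter `b`
(`nRelations_iff`). Splitting letters off `X` on the left and off `Z` on the right expresses the
associator `d(d(X, b), Z) - d(X, d(b, Z))` through the defects of this relation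
(`associator_prod_concat`, `associatorTail_prod_cons`), so that the associators vanish if and only
if the defects do (`relDefect_eq_zero`, `associator_prod_eq_zero`).

Conversely, let `W` be an `𝒩`-algebra. On `Tᶜ(W)`, with concatenation as product, let `D` be the
coderivation extending the operations of `W`, and let `d` be its Hochschild coboundary
`d(x, y) = D(x y) - D(x) y - x D(y)`, which is automatically a cocycle. The operations derived from
`d` restrict to those of `W` on letters (`listOp_map_of`), hence the associator of `d` vanishes
when the middle argument is a letter, and then everywhere, the associator of a cocycle being a
cocycle (`associator_mul_mid`). So `Tᶜ(W)` is a compatible associative algebra, and the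
deconcatenation coproduct satisfies the infinitesimal relations (`comul_mul`, `comul_d`).

For `W = 𝒩(V)`, the universal property of `As²(V)` gives a morphism `As²(V) → Tᶜ(𝒩(V))`, which
respects the coproducts. Its inverse is the multiplicative extension of the morphism of
`𝒩`-algebras `𝒩(V) → As²(V)`; it respects `d` as well (`lift_d`), and the two composites are the
identity on generators.
-/

noncomputable section

/-! ### Sums over the ways of cutting a list -/

section ListSums

variable {α M : Type*} [AddCommMonoid M]

/-- The sum of `F p s` over all ways to write `l = p ++ s` with `s` nonempty. -/
def sumSuffix (F : List α → List α → M) (l : List α) : M :=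
  ∑ j ∈ Finset.range l.length, F (l.take j) (l.drop j)

/-- The sum of `F p s` over all ways to write `l = p ++ s` with `p` nonempty. -/
def sumPrefix (F : List α → List α → M) (l : List α) : M :=
  ∑ j ∈ Finset.range l.length, F (l.take (j + 1)) (l.drop (j + 1))

theorem sumSuffix_singleton (F : List α → List α → M) (a : α) : sumSuffix F [a] = F [] [a] := by
  simp [sumSuffix]

theorem sumSuffix_cons (F : List α → List α → M) (a : α) (l : List α) :
    sumSuffix F (a :: l) = F [] (a :: l) + sumSuffix (fun p s => F (a :: p) s) l := by
  rw [sumSuffix, List.length_cons, Finset.sum_range_succ', add_comm]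
  rfl

theorem sumPrefix_singleton (F : List α → List α → M) (a : α) : sumPrefix F [a] = F [a] [] := by
  simp [sumPrefix]

theorem sumPrefix_concat (F : List α → List α → M) (l : List α) (a : α) :
    sumPrefix F (l ++ [a]) = sumPrefix (fun p s => F p (s ++ [a])) l + F (l ++ [a]) [] := by
  rw [sumPrefix, List.length_append, List.length_singleton, Finset.sum_range_succ, sumPrefix]
  congr 1
  · refine Finset.sum_congr rfl fun j hj => ?_
    have hj : j + 1 ≤ l.length := Finset.mem_range.mp hj
    rw [List.take_append_of_le_length hj, List.drop_append_of_le_length hj]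
  · rw [List.take_of_length_le (by simp), List.drop_of_length_le (by simp)]

theorem map_sumSuffix {β N : Type*} [AddCommMonoid N] (φ : M →+ N) (f : α → β)
    (F : List α → List α → M) (G : List β → List β → N)
    (h : ∀ p s, φ (F p s) = G (p.map f) (s.map f)) (l : List α) :
    φ (sumSuffix F l) = sumSuffix G (l.map f) := by
  simp [sumSuffix, h, List.map_take, List.map_drop]

theorem map_sumPrefix {β N : Type*} [AddCommMonoid N] (φ : M →+ N) (f : α → β)
    (F : List α → List α → M) (G : List β → List β → N)
    (h : ∀ p s, φ (F p s) = G (p.map f) (s.map f)) (l : List α) :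
    φ (sumPrefix F l) = sumPrefix G (l.map f) := by
  simp [sumPrefix, h, List.map_take, List.map_drop]

end ListSums

theorem List.ofFn_update {α : Type*} {n : ℕ} (x : Fin n → α) (i : Fin n) (a : α) :
    List.ofFn (Function.update x i a) =
      (List.ofFn x).take i ++ a :: (List.ofFn x).drop (i + 1) := by
  have h := List.set_eq_take_append_cons_drop (l := List.ofFn x) (i := i) (a := a)
  rw [if_pos (by simp)] at h
  rw [← h]
  refine List.ext_getElem (by simp) fun j h _ => ?_
  simp [List.getElem_set, Function.update_apply, Fin.ext_iff, eq_comm]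

/-- The three families of relations of an `𝒩`-algebra are the cases `Z = [c]`, `X = [a]`, and the
remaining one, of a single relation symmetric under reversal of words. -/
theorem nRelations_iff {A : Type*} [AddCommGroup A] (N : List A → A) :
    NRelations N ↔ ∀ (X : List A) (b : A) (Z : List A), X ≠ [] → Z ≠ [] →
      sumSuffix (fun p s => N (p ++ N (s ++ [b]) :: Z)) X =
        sumPrefix (fun p s => N (X ++ N (b :: p) :: s)) Z := by
  constructor
  · rintro h X b Z hX hZ
    obtain rfl | ⟨t, w, rfl⟩ := List.eq_nil_or_concat Z
    · exact absurd rfl hZ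
    rw [List.concat_eq_append]
    obtain rfl | ht := eq_or_ne t []
    · have := h.rel_one X b w (List.length_pos_iff.mpr hX)
      simpa [sumPrefix, sumSuffix] using this.symm
    have ht := List.length_pos_iff.mpr ht
    rw [sumPrefix_concat]
    match X, hX with
    | [a], _ =>
      have := h.rel_two a b t w ht
      rw [sumSuffix_singleton, sumPrefix]
      simp only [List.cons_append, List.nil_append] at this ⊢
      rw [this]
      abel
    | x :: a :: y, _ =>
      have := h.rel_three x (a :: y) b t w (by simp) ht
      rw [sumSuffix_cons, sumPrefix, sumSuffix]
      simp only [List.cons_append, List.nil_append, List.append_assoc] at this ⊢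
      rw [this]
      abel
  · intro h
    refine ⟨fun l a b hl => ?_, fun a b l c hl => ?_, fun x y z t w hy ht => ?_⟩
    · have := h l a [b] (List.length_pos_iff.mp hl) (by simp)
      simpa [sumPrefix, sumSuffix] using this.symm
    · have := h [a] b (l ++ [c]) (by simp) (by simp)
      rw [sumSuffix_singleton, sumPrefix_concat, sumPrefix] at this
      simp only [List.cons_append, List.nil_append] at this ⊢
      rw [this]
      abel
    · have := h (x :: y) z (t ++ [w]) (by simp) (by simp)
      rw [sumSuffix_cons, sumPrefix_concat, sumPrefix, sumSuffix] at this
      simp only [List.cons_append, List.nil_append, List.append_assoc] at this ⊢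
      rw [this]
      abel

/-! ### Associative algebras with a two-cocycle -/

/-- An associative product `mul` on `A` together with a Hochschild two-cocycle `d` with values
in `A`. A compatible associative algebra is the same thing, with `d` the difference of the two
products, subject to the condition that `d` be associative as well. -/
structure CocyclePair (K A : Type*) [Field K] [AddCommGroup A] [Module K A] where
  /-- the associative product -/
  mul : A →ₗ[K] A →ₗ[K] A
  /-- the cocycle -/
  d : A →ₗ[K] A →ₗ[K] A
  assoc : ∀ x y z, mul (mul x y) z = mul x (mul y z)
  cocycle : ∀ x y z, d (mul x y) z + mul (d x y) z = d x (mul y z) + mul x (d y z)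

namespace CocyclePair

variable {K A : Type*} [Field K] [AddCommGroup A] [Module K A] (P : CocyclePair K A)

/-- The product `a x₁ ⋯ xₙ` of a nonempty list, given by its head `a` and its tail. -/
def prod (a : A) (l : List A) : A := l.foldl (fun x y => P.mul x y) a

theorem prod_nil (a : A) : P.prod a [] = a := rfl

theorem prod_concat (a : A) (l : List A) (z : A) :
    P.prod a (l ++ [z]) = P.mul (P.prod a l) z := List.foldl_concat ..

theorem prod_append (a : A) (l m : List A) :
    P.prod a (l ++ m) = P.prod (P.prod a l) m := List.foldl_append ..

theorem prod_cons (a b : A) (l : List A) : P.prod a (b :: l) = P.mul a (P.prod b l) := by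
  induction l using List.reverseRecOn with
  | nil => rfl
  | append_singleton l z ih => rw [← List.cons_append, prod_concat, prod_concat, ih, P.assoc]

/-- The operator `x ↦ N(x, l)` on `A`, where `N` are the operations that will make `A` an
`𝒩`-algebra: `N(x, z) = d(x, z)`, and `N(x, b, l) = N(x b, l) - x N(b, l)` for nonempty `l`.
The operator is zero for empty `l`, in accordance with `onList`. -/
def theta : List A → A →ₗ[K] A
  | [] => 0
  | [z] => P.d.flip z
  | b :: c :: l => theta (c :: l) ∘ₗ P.mul.flip b - P.mul.flip (theta (c :: l) b)

theorem theta_nil (x : A) : P.theta [] x = 0 := rfl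

theorem theta_singleton (z x : A) : P.theta [z] x = P.d x z := rfl

theorem theta_cons (b : A) {l : List A} (hl : l ≠ []) (x : A) :
    P.theta (b :: l) x = P.theta l (P.mul x b) - P.mul x (P.theta l b) := by
  match l, hl with
  | c :: l, _ => rfl

theorem theta_append_add (l : List A) (a b : A) (r : List A) :
    P.theta (l ++ (a + b) :: r) = P.theta (l ++ a :: r) + P.theta (l ++ b :: r) := by
  ext x
  induction l generalizing x with
  | nil =>
    obtain rfl | hr := eq_or_ne r []
    · simp [theta_singleton]
    · simp only [List.nil_append, theta_cons _ _ hr, map_add, LinearMap.add_apply]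
      abel
  | cons y l ih =>
    simp only [List.cons_append, theta_cons _ _ (List.append_ne_nil_of_right_ne_nil l
      (List.cons_ne_nil _ r)), LinearMap.add_apply, ih, map_add]
    abel

theorem theta_append_smul (l : List A) (c : K) (a : A) (r : List A) :
    P.theta (l ++ (c • a) :: r) = c • P.theta (l ++ a :: r) := by
  ext x
  induction l generalizing x with
  | nil =>
    obtain rfl | hr := eq_or_ne r []
    · simp [theta_singleton]
    · simp only [List.nil_append, theta_cons _ _ hr, map_smul, LinearMap.smul_apply, smul_sub]
  | cons y l ih =>
    simp only [List.cons_append, theta_cons _ _ (List.append_ne_nil_of_right_ne_nil l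
      (List.cons_ne_nil _ r)), LinearMap.smul_apply, ih, map_smul, smul_sub]

theorem theta_add_cons (a b : A) (r : List A) (x : A) :
    P.theta ((a + b) :: r) x = P.theta (a :: r) x + P.theta (b :: r) x :=
  congrArg (fun f => f x) (P.theta_append_add [] a b r)

/-- Cutting off the last letter: `N(x, y, z) = d(x, y z) - d(x, y) z`, where `y` is a product. -/
theorem theta_concat (b : A) (l : List A) (z x : A) :
    P.theta (b :: (l ++ [z])) x =
      P.d x (P.mul (P.prod b l) z) - P.mul (P.d x (P.prod b l)) z := by
  induction l generalizing b x with
  | nil =>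
    rw [List.nil_append, theta_cons _ _ (by simp), theta_singleton, theta_singleton, prod_nil,
      sub_eq_sub_iff_add_eq_add]
    exact P.cocycle x b z
  | cons c l ih =>
    rw [List.cons_append, theta_cons _ _ (by simp), ih, ih, prod_cons]
    have h1 := P.cocycle x b (P.prod c l)
    have h2 := P.cocycle x b (P.mul (P.prod c l) z)
    have h3 := congrArg (fun t => P.mul t z) h1
    simp only [map_add, LinearMap.add_apply, P.assoc, map_sub] at h2 h3 ⊢
    rw [← sub_eq_zero] at h2 h3 ⊢
    rw [← sub_eq_zero.mpr (h2.trans h3.symm)]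
    abel

/-- The inner letters enter only through their product. -/
theorem theta_prod (b : A) (l : List A) {Z : List A} (hZ : Z ≠ []) :
    P.theta (P.prod b l :: Z) = P.theta (b :: (l ++ Z)) := by
  obtain rfl | ⟨t, w, rfl⟩ := List.eq_nil_or_concat Z
  · exact absurd rfl hZ
  ext x
  rw [List.concat_eq_append, ← List.append_assoc, theta_concat, theta_concat, prod_append]

/-- The family of all operations `N(x₁, …, xₙ)`, as a function on lists; zero on lists of
length at most one. -/
def listOp : List A → A
  | [] => 0
  | a :: l => P.theta l a

theorem listOp_cons (a : A) (l : List A) : P.listOp (a :: l) = P.theta l a := rfl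

theorem listOp_append_add (l : List A) (a b : A) (r : List A) :
    P.listOp (l ++ (a + b) :: r) = P.listOp (l ++ a :: r) + P.listOp (l ++ b :: r) := by
  cases l with
  | nil => exact map_add _ a b
  | cons y l => exact congrArg (fun f => f y) (P.theta_append_add l a b r)

theorem listOp_append_smul (l : List A) (c : K) (a : A) (r : List A) :
    P.listOp (l ++ (c • a) :: r) = c • P.listOp (l ++ a :: r) := by
  cases l with
  | nil => exact map_smul _ c a
  | cons y l => exact congrArg (fun f => f y) (P.theta_append_smul l c a r)

/-- The operation of arity `n + 2`. -/
def opMap (n : ℕ) : MultilinearMap K (fun _ : Fin (n + 2) => A) A where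
  toFun x := P.listOp (List.ofFn x)
  map_update_add' := by
    intro inst x i a b
    obtain rfl : inst = instDecidableEqFin (n + 2) := Subsingleton.elim _ _
    simp only [List.ofFn_update, listOp_append_add]
  map_update_smul' := by
    intro inst x i c a
    obtain rfl : inst = instDecidableEqFin (n + 2) := Subsingleton.elim _ _
    simp only [List.ofFn_update, listOp_append_smul]

theorem onList_opMap : onList (fun n => P.opMap n) = P.listOp := by
  funext l
  match l with
  | [] => rfl
  | [a] => rfl
  | a :: b :: l => exact congrArg P.listOp (List.ofFn_get (a :: b :: l))

/-- A letter of the form `d(x, b)` with `x` the product of `a :: l`, in an inner position, expands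
into the sum of `N(y, p, N(s, b), Z)` over all cuts of `a :: l` into `p` and `s`. -/
theorem theta_d_prod_left (a : A) (l : List A) (b y : A) {Z : List A} (hZ : Z ≠ []) :
    P.theta (P.d (P.prod a l) b :: Z) y =
      sumSuffix (fun p s => P.listOp (y :: p ++ P.listOp (s ++ [b]) :: Z)) (a :: l) := by
  induction l generalizing a y with
  | nil => rw [sumSuffix_singleton]; rfl
  | cons c l ih =>
    have h : P.d (P.mul a (P.prod c l)) b =
        P.theta (c :: (l ++ [b])) a + P.mul a (P.d (P.prod c l) b) := by
      rw [theta_concat, sub_add_eq_add_sub, eq_sub_iff_add_eq]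
      exact P.cocycle ..
    -- The product of `a` and `d(x, b)` may be replaced by two letters; then `theta_cons` at `a`
    -- reduces the claim to two instances of the induction hypothesis.
    have h' : P.theta (P.mul a (P.d (P.prod c l) b) :: Z) y =
        P.theta (a :: P.d (P.prod c l) b :: Z) y :=
      congrArg (fun f => f y) (P.theta_prod a [P.d (P.prod c l) b] hZ)
    rw [prod_cons, h, theta_add_cons, h', P.theta_cons a (List.cons_ne_nil _ _), ih, ih,
      sumSuffix_cons _ a]
    congr 1
    simp only [sumSuffix, map_sum, ← Finset.sum_sub_distrib]
    refine Finset.sum_congr rfl fun j _ => ?_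
    simp only [List.cons_append, listOp_cons]
    rw [theta_cons _ _ (List.append_ne_nil_of_right_ne_nil _ (List.cons_ne_nil _ _))]

/-- The mirror image of `theta_d_prod_left`. -/
theorem theta_d_prod_right (b z : A) (l : List A) (x : A) {U : List A} (hU : U ≠ []) :
    P.theta (P.d b (P.prod z l) :: U) x =
      sumPrefix (fun p s => P.theta (P.theta p b :: (s ++ U)) x) (z :: l) := by
  induction l using List.reverseRecOn generalizing U with
  | nil => rw [sumPrefix_singleton]; rfl
  | append_singleton l w ih =>
    have h : P.d b (P.mul (P.prod z l) w) =
        P.mul (P.d b (P.prod z l)) w + P.theta (z :: (l ++ [w])) b := by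
      rw [theta_concat]
      abel
    have h' : P.theta (P.mul (P.d b (P.prod z l)) w :: U) x =
        P.theta (P.d b (P.prod z l) :: w :: U) x :=
      congrArg (fun f => f x) (P.theta_prod (P.d b (P.prod z l)) [w] hU)
    rw [prod_concat, h, theta_add_cons, h', ih (by simp), ← List.cons_append, sumPrefix_concat]
    simp only [List.append_assoc, List.cons_append, List.nil_append]

theorem map_listOp {B : Type*} [AddCommGroup B] [Module K B] (Q : CocyclePair K B) (f : A →ₗ[K] B)
    (hmul : ∀ x y, f (P.mul x y) = Q.mul (f x) (f y)) (hd : ∀ x y, f (P.d x y) = Q.d (f x) (f y))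
    (l : List A) : f (P.listOp l) = Q.listOp (l.map f) := by
  match l with
  | [] => exact map_zero f
  | x :: l =>
    rw [List.map_cons, listOp_cons, listOp_cons]
    induction l generalizing x with
    | nil => exact map_zero f
    | cons b l ih =>
      obtain rfl | hl := eq_or_ne l []
      · exact hd x b
      · rw [List.map_cons, theta_cons _ _ hl, theta_cons _ _ (by simpa using hl), map_sub, ih, hmul,
          hmul, ih]

/-- The pair formed by an associative product and the Hochschild coboundary
`(x, y) ↦ D (x y) - (D x) y - x (D y)` of a linear map `D`. -/
def ofCochain (m : A →ₗ[K] A →ₗ[K] A) (hm : ∀ x y z, m (m x y) z = m x (m y z))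
    (D : A →ₗ[K] A) : CocyclePair K A where
  mul := m
  d := m.compr₂ D - m ∘ₗ D - m.compl₂ D
  assoc := hm
  cocycle x y z := by
    simp only [LinearMap.sub_apply, LinearMap.compr₂_apply, LinearMap.comp_apply,
      LinearMap.compl₂_apply, map_sub, hm]
    abel

/-- The associator of the cocycle. -/
def associator (x y z : A) : A := P.d (P.d x y) z - P.d x (P.d y z)

/-- The associator of a cocycle is a Hochschild three-cocycle. -/
theorem associator_mul_mid (x y u z : A) : P.associator x (P.mul y u) z =
    P.associator (P.mul x y) u z - P.mul x (P.associator y u z) +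
      P.associator x y (P.mul u z) - P.mul (P.associator x y u) z := by
  have h1 := congrArg (fun t => P.d t z) (P.cocycle x y u)
  have h2 := congrArg (fun t => P.d x t) (P.cocycle y u z)
  have h3 := P.cocycle (P.d x y) u z
  have h4 := P.cocycle x (P.d y u) z
  have h5 := P.cocycle x y (P.d u z)
  simp only [map_add, LinearMap.add_apply] at h1 h2
  simp only [associator, map_sub, LinearMap.sub_apply]
  linear_combination (norm := module) h3 + h5 - h1 - h2 - h4

/-- The defect of the relation of `nRelations_iff` for the operations `listOp`. -/
def relDefect (X : List A) (b : A) (Z : List A) : A :=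
  sumSuffix (fun p s => P.listOp (p ++ P.listOp (s ++ [b]) :: Z)) X -
    sumPrefix (fun p s => P.listOp (X ++ P.listOp (b :: p) :: s)) Z

/-- The correction term in the recursion `associator_prod_concat` for the associator of `x`, `b` and
the product of a word `Z`, by which the last letter of `Z` is split off. -/
def associatorTail (x b : A) (Z : List A) : A :=
  P.theta Z (P.d x b) - sumPrefix (fun p s => P.theta (P.theta p b :: s) x) Z

theorem associator_eq_tail (x b z : A) : P.associator x b z = P.associatorTail x b [z] := by
  rw [associatorTail, sumPrefix_singleton]
  rfl

theorem associator_prod_concat (x b z : A) (l : List A) (u : A) :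
    P.associator x b (P.prod z (l ++ [u])) =
      P.mul (P.associator x b (P.prod z l)) u + P.associatorTail x b (z :: (l ++ [u])) := by
  have h1 := P.theta_concat z l u (P.d x b)
  have h2 := congrArg (P.d x) (P.theta_concat z l u b)
  have h3 := P.theta_d_prod_right b z l x (List.cons_ne_nil u [])
  have h4 := P.theta_concat (P.d b (P.prod z l)) [] u x
  rw [List.nil_append, prod_nil] at h4
  rw [h4] at h3
  rw [associatorTail, ← List.cons_append, sumPrefix_concat, ← h3, List.cons_append, h1,
    theta_singleton, h2, prod_concat]
  simp only [associator, map_sub, LinearMap.sub_apply]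
  abel

theorem associatorTail_eq_relDefect (a b : A) {Z : List A} :
    P.associatorTail a b Z = P.relDefect [a] b Z := by
  rw [relDefect, sumSuffix_singleton]
  rfl

/-- The first letter of `y a l` is split off, with the defect as correction term. Together with
`associator_prod_concat` this expresses the associator through the defects and conversely. -/
theorem associatorTail_prod_cons (y a : A) (l : List A) (b : A) {Z : List A} (hZ : Z ≠ []) :
    P.associatorTail (P.prod y (a :: l)) b Z =
      P.mul y (P.associatorTail (P.prod a l) b Z) + P.relDefect (y :: a :: l) b Z := by
  have h1 : P.d (P.mul y (P.prod a l)) b =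
      P.theta (a :: (l ++ [b])) y + P.mul y (P.d (P.prod a l) b) := by
    rw [theta_concat, sub_add_eq_add_sub, eq_sub_iff_add_eq]
    exact P.cocycle ..
  have h2 := P.theta_cons (P.d (P.prod a l) b) hZ y
  rw [theta_d_prod_left _ _ _ _ _ hZ] at h2
  have h3 : ∀ c s, P.theta (c :: s) (P.mul y (P.prod a l)) =
      P.theta (a :: (l ++ c :: s)) y + P.mul y (P.theta (c :: s) (P.prod a l)) := by
    intro c s
    rw [← theta_prod _ _ _ (List.cons_ne_nil _ _), theta_cons _ _ (List.cons_ne_nil _ _),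
      sub_add_cancel]
  rw [associatorTail, associatorTail, relDefect, sumSuffix_cons, prod_cons, h1, map_add]
  simp only [h3, sumPrefix, Finset.sum_add_distrib, map_sub, map_sum]
  simp only [List.cons_append, List.nil_append, listOp_cons] at h2 ⊢
  rw [h2]
  abel

/-- If the cocycle is associative, then the operations `listOp` form an `𝒩`-algebra. -/
theorem relDefect_eq_zero (h : ∀ x y z, P.associator x y z = 0) {X : List A} (hX : X ≠ []) (b : A)
    {Z : List A} (hZ : Z ≠ []) : P.relDefect X b Z = 0 := by
  have key : ∀ x, P.associatorTail x b Z = 0 := by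
    intro x
    match Z, hZ with
    | z :: l, _ =>
      obtain rfl | ⟨t, w, rfl⟩ := List.eq_nil_or_concat l
      · rw [← associator_eq_tail, h]
      · have := P.associator_prod_concat x b z t w
        rw [h, h, map_zero, LinearMap.zero_apply, zero_add] at this
        rw [List.concat_eq_append, ← this]
  match X, hX with
  | [a], _ => rw [← associatorTail_eq_relDefect, key]
  | y :: a :: l, _ =>
    have := P.associatorTail_prod_cons y a l b hZ
    rw [key, key, map_zero, zero_add] at this
    exact this.symm

/-- If the relations of an `𝒩`-algebra hold for letters in `S`, then the cocycle is associative on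
products of letters in `S`, as long as the middle factor is a single letter. -/
theorem associator_prod_eq_zero (S : Set A)
    (h : ∀ X b Z, (∀ x ∈ X, x ∈ S) → b ∈ S → (∀ z ∈ Z, z ∈ S) → X ≠ [] → Z ≠ [] →
      P.relDefect X b Z = 0)
    {a b z : A} {l m : List A} (hX : ∀ x ∈ a :: l, x ∈ S) (hb : b ∈ S)
    (hZ : ∀ x ∈ z :: m, x ∈ S) : P.associator (P.prod a l) b (P.prod z m) = 0 := by
  have key : ∀ Z, (∀ z ∈ Z, z ∈ S) → Z ≠ [] → P.associatorTail (P.prod a l) b Z = 0 := by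
    intro Z hZ hZ'
    induction l generalizing a with
    | nil => rw [prod_nil, associatorTail_eq_relDefect, h _ _ _ hX hb hZ (by simp) hZ']
    | cons c l ih =>
      rw [associatorTail_prod_cons _ _ _ _ _ hZ', h _ _ _ hX hb hZ (by simp) hZ',
        ih fun x hx => hX x (List.mem_cons_of_mem _ hx), map_zero, zero_add]
  induction m using List.reverseRecOn with
  | nil => rw [prod_nil, associator_eq_tail, key _ hZ (by simp)]
  | append_singleton m u ih =>
    rw [associator_prod_concat, key _ hZ (by simp), ih fun x hx => hZ x (by
      rw [← List.cons_append]
      exact List.mem_append_left _ hx), map_zero, LinearMap.zero_apply, zero_add]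

/-- An associative algebra with an associative two-cocycle is an `𝒩`-algebra. -/
abbrev toNAlgebra (h : ∀ x y z, P.associator x y z = 0) : NAlgebra K A where
  op := P.opMap
  relations := by
    rw [onList_opMap, nRelations_iff]
    intro X b Z hX hZ
    exact sub_eq_zero.mp (P.relDefect_eq_zero h hX b hZ)

/-- The compatible associative algebra with products `mul` and `mul + d`. -/
abbrev toCompatAssocAlgebra (h : ∀ x y z, P.associator x y z = 0) : CompatAssocAlgebra K A where
  dot := P.mul
  circ := P.mul + P.d
  dot_assoc := P.assoc
  circ_assoc x y z := by
    have h1 := P.cocycle x y z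
    have h2 := h x y z
    simp only [associator, LinearMap.add_apply, map_add, P.assoc] at h1 h2 ⊢
    linear_combination (norm := module) h1 + h2
  sum_assoc x y z := by
    have h1 := P.cocycle x y z
    have h2 := h x y z
    simp only [associator, LinearMap.add_apply, map_add, P.assoc] at h1 h2 ⊢
    linear_combination (norm := module) h1 + h1 + h2

variable (K A) in
/-- The two products of a compatible associative algebra, the second one measured by its
difference from the first one. -/
def ofCompat [CompatAssocAlgebra K A] : CocyclePair K A where
  mul := CompatAssocAlgebra.dot
  d := CompatAssocAlgebra.circ - CompatAssocAlgebra.dot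
  assoc := CompatAssocAlgebra.dot_assoc
  cocycle x y z := by
    have h1 := CompatAssocAlgebra.circ_assoc (K := K) x y z
    have h2 := CompatAssocAlgebra.sum_assoc (K := K) x y z
    simp only [LinearMap.add_apply, LinearMap.sub_apply, map_add, map_sub,
      CompatAssocAlgebra.dot_assoc] at h1 h2 ⊢
    linear_combination (norm := module) h2 - h1

theorem ofCompat_associator [CompatAssocAlgebra K A] (x y z : A) :
    (ofCompat K A).associator x y z = 0 := by
  have h1 := CompatAssocAlgebra.circ_assoc (K := K) x y z
  have h2 := CompatAssocAlgebra.sum_assoc (K := K) x y z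
  simp only [associator, ofCompat, LinearMap.add_apply, LinearMap.sub_apply, map_add, map_sub,
      CompatAssocAlgebra.dot_assoc] at h1 h2 ⊢
  linear_combination (norm := module) h1 + h1 - h2

end CocyclePair

/-! ### The tensor algebra structure of `Tᶜ(W)` -/

theorem rTensor_lTensor_comm {R M N : Type*} [CommSemiring R] [AddCommMonoid M] [AddCommMonoid N]
    [Module R M] [Module R N] (f : M →ₗ[R] M) (g : N →ₗ[R] N) (t : M ⊗[R] N) :
    f.rTensor N (g.lTensor M t) = g.lTensor M (f.rTensor N t) := by
  induction t using TensorProduct.induction_on with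
  | zero => simp only [map_zero]
  | tmul x y => rfl
  | add x y hx hy => simp only [map_add, hx, hy]

theorem Fin.cons_eq_of_val {W : Type*} {n : ℕ} (w : W) (x : Fin n → W) (i : Fin (n + 1)) (k : Fin n)
    (h : (i : ℕ) = k + 1) : (Fin.cons w x : Fin (n + 1) → W) i = x k := by
  obtain rfl : i = k.succ := Fin.ext h
  rfl

namespace TensorCoalg

variable {K W : Type*} [Field K] [AddCommGroup W] [Module K W]

theorem word_congr {n m : ℕ} (h : n = m) {x : Fin (n + 1) → W} {y : Fin (m + 1) → W}
    (hxy : ∀ i : Fin (n + 1), x i = y (i.cast (by rw [h]))) : word K W n x = word K W m y := by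
  subst h
  exact congrArg _ (funext hxy)

theorem linearMap_ext {M : Type*} [AddCommMonoid M] [Module K M] {f g : TensorCoalg K W →ₗ[K] M}
    (h : ∀ n x, f (word K W n x) = g (word K W n x)) : f = g :=
  DirectSum.linearMap_ext K fun n => PiTensorProduct.ext (MultilinearMap.ext (h n))

variable (K W) in
/-- The inclusion of letters. -/
def of : W →ₗ[K] TensorCoalg K W :=
  (MultilinearMap.ofSubsingleton K W (TensorCoalg K W) (0 : Fin 1)).symm (word K W 0)

theorem of_apply (w : W) : of K W w = word K W 0 (fun _ => w) := rfl

variable (K W) in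
/-- Prepending a letter to a word. Words are built in this way, which avoids computing with
positions: see `induction_cons`. -/
def cons : W →ₗ[K] TensorCoalg K W →ₗ[K] TensorCoalg K W where
  toFun w := DirectSum.toModule K ℕ _ fun n =>
    PiTensorProduct.lift ((word K W (n + 1)).curryLeft w)
  map_add' w w' := linearMap_ext fun n x => by
    simp [word, DirectSum.toModule_lof]
  map_smul' c w := linearMap_ext fun n x => by
    simp [word, DirectSum.toModule_lof]

theorem cons_word (w : W) (n : ℕ) (x : Fin (n + 1) → W) :
    cons K W w (word K W n x) = word K W (n + 1) (Fin.cons w x) := by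
  simp [cons, word, DirectSum.toModule_lof]

theorem induction_cons {P : TensorCoalg K W → Prop} (x : TensorCoalg K W)
    (of : ∀ w, P (of K W w)) (add : ∀ x y, P x → P y → P (x + y))
    (smul : ∀ (c : K) x, P x → P (c • x)) (cons : ∀ w x, P x → P (cons K W w x)) : P x := by
  let S : Submodule K (TensorCoalg K W) :=
    { carrier := {x | P x}
      add_mem' := fun {x y} => add x y
      zero_mem' := by simpa using of 0
      smul_mem' := smul }
  have hw : ∀ n w, word K W n w ∈ S := by
    intro n
    induction n with
    | zero =>
      intro w
      rw [show word K W 0 w = TensorCoalg.of K W (w 0) from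
        word_congr rfl fun i => congrArg w (Subsingleton.elim (α := Fin 1) _ _)]
      exact of _
    | succ n ih =>
      intro w
      rw [← Fin.cons_self_tail w, ← cons_word]
      exact cons _ _ (ih _)
  have h : S.mkQ = 0 := linearMap_ext fun n w => by simpa using hw n w
  have hx : S.mkQ x = 0 := by rw [h, LinearMap.zero_apply]
  exact (Submodule.Quotient.mk_eq_zero S).mp hx

variable (K W) in
/-- Concatenation of words: `w₁ ⋯ wₙ` acts by prepending `wₙ`, …, `w₁` in turn. -/
def mul : TensorCoalg K W →ₗ[K] TensorCoalg K W →ₗ[K] TensorCoalg K W :=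
  DirectSum.toModule K ℕ _ fun n => PiTensorProduct.lift
    ((MultilinearMap.mkPiAlgebraFin K (n + 1) (Module.End K (TensorCoalg K W))).compLinearMap
      fun _ => cons K W)

theorem mul_word (n : ℕ) (x : Fin (n + 1) → W) :
    mul K W (word K W n x) = (List.ofFn fun i => cons K W (x i)).prod := by
  simp [mul, word, DirectSum.toModule_lof]

theorem mul_of (w : W) : mul K W (of K W w) = cons K W w := by
  rw [of_apply, mul_word]
  simp

theorem mul_cons (w : W) (x : TensorCoalg K W) :
    mul K W (cons K W w x) = cons K W w ∘ₗ mul K W x := by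
  have : mul K W ∘ₗ cons K W w =
      LinearMap.llcomp K _ _ _ (cons K W w) ∘ₗ mul K W := linearMap_ext fun n x => by
    simp only [LinearMap.comp_apply, cons_word, mul_word, List.ofFn_succ, List.prod_cons]
    rfl
  exact congrArg (fun f => f x) this

theorem mul_assoc (x y z : TensorCoalg K W) :
    mul K W (mul K W x y) z = mul K W x (mul K W y z) := by
  induction x using induction_cons with
  | of w => simp [mul_of, mul_cons]
  | add x x' hx hx' => simp [hx, hx']
  | smul c x hx => simp [hx]
  | cons w x hx => simp [mul_cons, hx]

/-- Words are built by appending letters on the right, too. -/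
theorem induction_concat {P : TensorCoalg K W → Prop} (x : TensorCoalg K W)
    (of : ∀ w, P (of K W w)) (add : ∀ x y, P x → P y → P (x + y))
    (smul : ∀ (c : K) x, P x → P (c • x))
    (concat : ∀ x w, P x → P (mul K W x (TensorCoalg.of K W w))) : P x := by
  have key : ∀ x y, P y → P (mul K W y x) := by
    intro x
    induction x using induction_cons with
    | of w => exact fun y => concat y w
    | add x x' hx hx' =>
      intro y hy
      rw [map_add]
      exact add _ _ (hx y hy) (hx' y hy)
    | smul c x hx =>
      intro y hy
      rw [map_smul]
      exact smul _ _ (hx y hy)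
    | cons w x hx =>
      intro y hy
      rw [← mul_of, ← mul_assoc]
      exact hx _ (concat y w hy)
  induction x using induction_cons with
  | of w => exact of w
  | add x x' hx hx' => exact add _ _ hx hx'
  | smul c x hx => exact smul _ _ hx
  | cons w x hx =>
    rw [← mul_of]
    exact key _ _ (of w)

/-! ### Deconcatenation and concatenation -/

theorem comul_of (w : W) : comul K W (of K W w) = 0 := by
  rw [of_apply, comul_word]
  simp

theorem comul_cons (w : W) (x : TensorCoalg K W) :
    comul K W (cons K W w x) = of K W w ⊗ₜ[K] x + (cons K W w).rTensor _ (comul K W x) := by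
  have : comul K W ∘ₗ cons K W w =
      TensorProduct.mk K _ _ (of K W w) + (cons K W w).rTensor _ ∘ₗ comul K W :=
    linearMap_ext fun n x => by
      simp only [LinearMap.comp_apply, LinearMap.add_apply, cons_word, comul_word,
        Fin.sum_univ_succ, map_sum, LinearMap.rTensor_tmul, TensorProduct.mk_apply]
      congr 1
      · congr 1
        · refine word_congr rfl fun j => ?_
          obtain rfl : j = 0 := Subsingleton.elim (α := Fin 1) _ _
          rfl
        · exact word_congr rfl fun j => Fin.cons_eq_of_val w x _ _
            (by change 0 + 1 + (j : ℕ) = j + 1; omega)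
      · refine Finset.sum_congr rfl fun i _ => ?_
        congr 1
        · refine word_congr rfl fun j => ?_
          refine Fin.cases rfl (fun k => ?_) j
          rfl
        · exact word_congr (by simp only [Fin.val_succ]; omega) fun j =>
            Fin.cons_eq_of_val w x _ _ (by simp; omega)
  exact congrArg (fun f => f x) this

/-- Deconcatenation is a derivation up to a correction term, with respect to concatenation. -/
theorem comul_mul (x y : TensorCoalg K W) : comul K W (mul K W x y) =
    ((mul K W).flip y).lTensor _ (comul K W x) + (mul K W x).rTensor _ (comul K W y) +
      x ⊗ₜ[K] y := by
  induction x using induction_cons with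
  | of w =>
    rw [comul_of, mul_of, comul_cons, map_zero, zero_add, add_comm]
  | add x x' hx hx' =>
    simp only [map_add, LinearMap.add_apply, hx, hx', LinearMap.rTensor_add, TensorProduct.add_tmul]
    abel
  | smul c x hx =>
    simp only [map_smul, LinearMap.smul_apply, hx, LinearMap.rTensor_smul, smul_add,
      TensorProduct.smul_tmul']
  | cons w x hx =>
    simp only [mul_cons, LinearMap.comp_apply, comul_cons, hx, map_add, rTensor_lTensor_comm,
      LinearMap.rTensor_comp, LinearMap.lTensor_tmul, LinearMap.rTensor_tmul, LinearMap.flip_apply]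
    abel

/-! ### The universal property of concatenation -/

section Lift

variable {A : Type*} [AddCommGroup A] [Module K A] (m : A →ₗ[K] A →ₗ[K] A) (ψ : W →ₗ[K] A)

/-- The multiplicative extension of a linear map `ψ : W → A`, for a product `m` on `A`; the product
of the images of the letters is bracketed to the right. -/
def lift : TensorCoalg K W →ₗ[K] A :=
  DirectSum.toModule K ℕ _ fun n => PiTensorProduct.lift (MultilinearMap.uncurryRight
    ((LinearMap.lcomp K A ψ).compMultilinearMap
      ((MultilinearMap.mkPiAlgebraFin K n (Module.End K A)).compLinearMap fun _ => m ∘ₗ ψ)))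

theorem lift_word (n : ℕ) (x : Fin (n + 1) → W) : lift m ψ (word K W n x) =
    (List.ofFn fun i : Fin n => m (ψ (x i.castSucc))).prod (ψ (x (Fin.last n))) := by
  simp [lift, word, DirectSum.toModule_lof]
  rfl

theorem lift_of (w : W) : lift m ψ (of K W w) = ψ w := by
  rw [of_apply, lift_word]
  simp

theorem lift_cons (w : W) (x : TensorCoalg K W) :
    lift m ψ (cons K W w x) = m (ψ w) (lift m ψ x) := by
  have : lift m ψ ∘ₗ cons K W w = m (ψ w) ∘ₗ lift m ψ := linearMap_ext fun n x => by
    simp only [LinearMap.comp_apply, cons_word, lift_word, List.ofFn_succ, List.prod_cons]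
    rfl
  exact congrArg (fun f => f x) this

theorem lift_mul (hm : ∀ x y z, m (m x y) z = m x (m y z)) (x y : TensorCoalg K W) :
    lift m ψ (mul K W x y) = m (lift m ψ x) (lift m ψ y) := by
  induction x using induction_cons with
  | of w => rw [mul_of, lift_cons, lift_of]
  | add x x' hx hx' => simp [hx, hx']
  | smul c x hx => simp [hx]
  | cons w x hx => simp [mul_cons, lift_cons, hx, hm]

end Lift

/-! ### The cocycle defined by an `𝒩`-algebra -/

section NAlgebra

variable [NAlgebra K W]

variable (K W) in
/-- The operations of an `𝒩`-algebra as one linear map on words, zero on letters. -/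
def evalOp : TensorCoalg K W →ₗ[K] W :=
  DirectSum.toModule K ℕ W fun n =>
    match n with
    | 0 => 0
    | n + 1 => PiTensorProduct.lift (NAlgebra.op n)

theorem evalOp_of (w : W) : evalOp K W (of K W w) = 0 := by
  simp [of_apply, evalOp, word, DirectSum.toModule_lof]

theorem evalOp_word (n : ℕ) (x : Fin (n + 2) → W) :
    evalOp K W (word K W (n + 1) x) = NAlgebra.op (K := K) n x := by
  simp [evalOp, word, DirectSum.toModule_lof]

variable (K W) in
/-- `w₁ ⋯ wₙ ↦ ∑ᵢ w₁ ⋯ wᵢ₋₁ N(wᵢ, …, wₙ)`, over `i < n`. -/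
def evalSuffix : TensorCoalg K W →ₗ[K] TensorCoalg K W :=
  of K W ∘ₗ evalOp K W + TensorProduct.lift (mul K W) ∘ₗ
    (of K W ∘ₗ evalOp K W).lTensor _ ∘ₗ comul K W

/-- A letter has no suffix of length at least two, and `evalOp` vanishes on the suffix of length
one. -/
theorem evalSuffix_of (w : W) : evalSuffix K W (of K W w) = 0 := by
  simp [evalSuffix, evalOp_of, comul_of]

theorem evalSuffix_cons (w : W) (x : TensorCoalg K W) : evalSuffix K W (cons K W w x) =
    of K W (evalOp K W (cons K W w x)) + cons K W w (evalSuffix K W x) := by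
  have h : ∀ t, TensorProduct.lift (mul K W) ((of K W ∘ₗ evalOp K W).lTensor _
      ((cons K W w).rTensor _ t)) = cons K W w (TensorProduct.lift (mul K W)
        ((of K W ∘ₗ evalOp K W).lTensor _ t)) := by
    intro t
    induction t using TensorProduct.induction_on with
    | zero => simp
    | tmul x y => simp [mul_cons]
    | add x y hx hy => simp only [map_add, hx, hy]
  simp only [evalSuffix, LinearMap.add_apply, LinearMap.comp_apply, comul_cons, map_add, h,
    LinearMap.lTensor_tmul, TensorProduct.lift.tmul, mul_of]

variable (K W) in
/-- The coderivation `w₁ ⋯ wₙ ↦ ∑ᵢⱼ w₁ ⋯ wᵢ₋₁ N(wᵢ, …, wⱼ) wⱼ₊₁ ⋯ wₙ`, over `i < j`. -/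
def coder : TensorCoalg K W →ₗ[K] TensorCoalg K W :=
  evalSuffix K W + TensorProduct.lift (mul K W) ∘ₗ
    (evalSuffix K W).rTensor _ ∘ₗ comul K W

theorem coder_of (w : W) : coder K W (of K W w) = 0 := by
  simp [coder, evalSuffix_of, comul_of]

theorem coder_concat (x : TensorCoalg K W) (w : W) : coder K W (mul K W x (of K W w)) =
    evalSuffix K W (mul K W x (of K W w)) + mul K W (coder K W x) (of K W w) := by
  have h : ∀ t, TensorProduct.lift (mul K W) ((evalSuffix K W).rTensor _
      (((mul K W).flip (of K W w)).lTensor _ t)) = mul K W (TensorProduct.lift (mul K W)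
        ((evalSuffix K W).rTensor _ t)) (of K W w) := by
    intro t
    induction t using TensorProduct.induction_on with
    | zero => simp
    | tmul x y => simp [mul_assoc]
    | add x y hx hy => simp only [map_add, LinearMap.add_apply, hx, hy]
  simp only [coder, LinearMap.add_apply, LinearMap.comp_apply, comul_mul, comul_of, map_add,
    map_zero, add_zero, h, LinearMap.rTensor_tmul, TensorProduct.lift.tmul]
  abel

variable (K W) in
/-- Concatenation, together with the Hochschild coboundary
`d(w₁ ⋯ wₚ, wₚ₊₁ ⋯ wₙ) = ∑ w₁ ⋯ wᵢ₋₁ N(wᵢ, …, wⱼ) wⱼ₊₁ ⋯ wₙ`, over `i ≤ p < j`,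
of the coderivation `coder`. -/
def cocyclePair : CocyclePair K (TensorCoalg K W) :=
  .ofCochain (mul K W) mul_assoc (coder K W)

theorem cocyclePair_mul : (cocyclePair K W).mul = mul K W := rfl

theorem cocyclePair_d (x y : TensorCoalg K W) : (cocyclePair K W).d x y =
    coder K W (mul K W x y) - mul K W (coder K W x) y - mul K W x (coder K W y) := rfl

/-- For a letter in the first argument, `d` is computed by splitting letters off the second one;
this lemma and `d_of_concat` are all that is needed about `coder` from here on. -/
theorem d_of_of (w z : W) : (cocyclePair K W).d (of K W w) (of K W z) =
    of K W (evalOp K W (cons K W w (of K W z))) := by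
  rw [cocyclePair_d, coder_concat, mul_of, evalSuffix_cons]
  simp [coder_of, evalSuffix_of]

theorem d_of_concat (w : W) (y : TensorCoalg K W) (z : W) :
    (cocyclePair K W).d (of K W w) (mul K W y (of K W z)) =
      mul K W ((cocyclePair K W).d (of K W w) y) (of K W z) +
        of K W (evalOp K W (cons K W w (mul K W y (of K W z)))) := by
  simp only [cocyclePair_d, ← mul_assoc, coder_concat]
  simp only [mul_of, evalSuffix_cons, coder_of, map_add, map_sub, map_zero,
    LinearMap.sub_apply, LinearMap.zero_apply, mul_cons, LinearMap.comp_apply]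
  abel

/-- Unlike a product, `d` has no correction term: the coproduct of `d(x, y)` is
`x₁ ⊗ d(x₂, y) + d(x, y₁) ⊗ y₂`. -/
theorem comul_d (x y : TensorCoalg K W) : comul K W ((cocyclePair K W).d x y) =
    ((cocyclePair K W).d.flip y).lTensor _ (comul K W x) +
      ((cocyclePair K W).d x).rTensor _ (comul K W y) := by
  have hof : ∀ w y, comul K W ((cocyclePair K W).d (of K W w) y) =
      ((cocyclePair K W).d (of K W w)).rTensor _ (comul K W y) := by
    intro w y
    induction y using induction_concat with
    | of z => rw [d_of_of, comul_of, comul_of, map_zero]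
    | add y y' hy hy' => simp only [map_add, hy, hy']
    | smul c y hy => simp only [map_smul, hy]
    | concat y z hy =>
      simp only [d_of_concat, map_add, comul_mul, comul_of, hy, map_zero, add_zero,
        rTensor_lTensor_comm, LinearMap.rTensor_tmul]
  induction x using induction_cons with
  | of w => rw [hof, comul_of, map_zero, zero_add]
  | add x x' hx hx' =>
    simp only [map_add, LinearMap.add_apply, hx, hx', LinearMap.rTensor_add]
    abel
  | smul c x hx => simp only [map_smul, LinearMap.smul_apply, hx, LinearMap.rTensor_smul, smul_add]
  | cons w x hx =>
    -- The cocycle identity reduces `d(w x, y)` to values at `w` and at `x`.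
    have hd : ∀ y, (cocyclePair K W).d (cons K W w x) y = cons K W w ((cocyclePair K W).d x y) +
        (cocyclePair K W).d (of K W w) (mul K W x y) -
          mul K W ((cocyclePair K W).d (of K W w) x) y := by
      intro y
      have := (cocyclePair K W).cocycle (of K W w) x y
      simp only [cocyclePair_mul, mul_of] at this
      rw [eq_sub_iff_add_eq, this, add_comm]
    have hd' : ∀ t : TensorCoalg K W ⊗[K] TensorCoalg K W,
        ((cocyclePair K W).d (cons K W w x)).rTensor _ t =
          (cons K W w).rTensor _ (((cocyclePair K W).d x).rTensor _ t) +
          ((cocyclePair K W).d (of K W w)).rTensor _ ((mul K W x).rTensor _ t) -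
          (mul K W ((cocyclePair K W).d (of K W w) x)).rTensor _ t := by
      intro t
      induction t using TensorProduct.induction_on with
      | zero =>
        simp only [map_zero, add_zero]
        exact (sub_zero (0 : TensorCoalg K W ⊗[K] TensorCoalg K W)).symm
      | tmul u v =>
        simp only [LinearMap.rTensor_tmul, hd, TensorProduct.add_tmul, TensorProduct.sub_tmul]
      | add s t hs ht =>
        simp only [map_add, hs, ht]
        abel
    simp only [hd, hd', map_add, map_sub, comul_cons, comul_mul, hof, hx, rTensor_lTensor_comm,
      LinearMap.lTensor_tmul, LinearMap.rTensor_tmul, LinearMap.flip_apply]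
    abel

/-! ### Associativity of the cocycle -/

theorem prod_map_of (a : W) (l : List W) : (cocyclePair K W).prod (of K W a) (l.map (of K W)) =
    word K W l.length (fun i => (a :: l).get i) := by
  induction l generalizing a with
  | nil =>
    refine word_congr rfl fun i => ?_
    obtain rfl : i = 0 := Subsingleton.elim (α := Fin 1) _ _
    rfl
  | cons b l ih =>
    rw [List.map_cons, CocyclePair.prod_cons, ih, cocyclePair_mul, mul_of, cons_word]
    refine word_congr rfl fun i => ?_
    refine Fin.cases rfl (fun k => ?_) i
    rfl

/-- `Tᶜ(W)` is spanned by products of letters. -/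
theorem induction_prod {P : TensorCoalg K W → Prop} (x : TensorCoalg K W)
    (prod : ∀ (a : W) (l : List W), P ((cocyclePair K W).prod (of K W a) (l.map (of K W))))
    (add : ∀ x y, P x → P y → P (x + y)) (smul : ∀ (c : K) x, P x → P (c • x)) : P x := by
  let S := Submodule.span K {x | ∃ (a : W) (l : List W),
    (cocyclePair K W).prod (of K W a) (l.map (of K W)) = x}
  have hS : ∀ x, x ∈ S := by
    intro x
    induction x using induction_cons with
    | of w => exact Submodule.subset_span ⟨w, [], rfl⟩
    | add x y hx hy => exact S.add_mem hx hy
    | smul c x hx => exact S.smul_mem c hx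
    | cons w x hx =>
      induction hx using Submodule.span_induction with
      | mem x hx =>
        obtain ⟨a, l, rfl⟩ := hx
        refine Submodule.subset_span ⟨w, a :: l, ?_⟩
        rw [List.map_cons, CocyclePair.prod_cons, cocyclePair_mul, mul_of]
      | zero => rw [map_zero]; exact S.zero_mem
      | add x y _ _ hx hy => rw [map_add]; exact S.add_mem hx hy
      | smul c x _ hx => rw [map_smul]; exact S.smul_mem c hx
  induction hS x using Submodule.span_induction with
  | mem x hx =>
    obtain ⟨a, l, rfl⟩ := hx
    exact prod a l
  | zero => simpa using smul 0 _ (prod 0 [])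
  | add x y _ _ hx hy => exact add _ _ hx hy
  | smul c x _ hx => exact smul _ _ hx

theorem evalOp_prod (a : W) (l : List W) :
    evalOp K W ((cocyclePair K W).prod (of K W a) (l.map (of K W))) =
      onList (fun n => NAlgebra.op (K := K) (A := W) n) (a :: l) := by
  match l with
  | [] => exact evalOp_of a
  | b :: l =>
    rw [prod_map_of]
    exact evalOp_word _ _

/-- On letters, the operations of `Tᶜ(W)` are those of `W`. -/
theorem listOp_map_of (l : List W) : (cocyclePair K W).listOp (l.map (of K W)) =
    of K W (onList (fun n => NAlgebra.op (K := K) (A := W) n) l) := by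
  match l with
  | [] => exact (map_zero (of K W)).symm
  | a :: l =>
    rw [← evalOp_prod, List.map_cons, CocyclePair.listOp_cons]
    match l with
    | [] => rw [List.map_nil, CocyclePair.prod_nil, evalOp_of, map_zero, CocyclePair.theta_nil]
    | b :: l =>
      rw [List.map_cons, CocyclePair.prod_cons, cocyclePair_mul, mul_of]
      obtain rfl | ⟨t, z, rfl⟩ := List.eq_nil_or_concat l
      · rw [List.map_nil, CocyclePair.theta_singleton, CocyclePair.prod_nil, d_of_of]
      · rw [List.concat_eq_append, List.map_append, List.map_singleton, CocyclePair.theta_concat,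
          CocyclePair.prod_concat, cocyclePair_mul, d_of_concat, add_sub_cancel_left]

theorem relDefect_map_of {X : List W} (hX : X ≠ []) (b : W) {Z : List W} (hZ : Z ≠ []) :
    (cocyclePair K W).relDefect (X.map (of K W)) (of K W b) (Z.map (of K W)) = 0 := by
  have h := (nRelations_iff _).mp (NAlgebra.relations (K := K) (A := W)) X b Z hX hZ
  have h1 := congrArg (of K W).toAddMonoidHom h
  rw [map_sumSuffix (of K W).toAddMonoidHom (of K W) _ (fun p s => (cocyclePair K W).listOp
      (p ++ (cocyclePair K W).listOp (s ++ [of K W b]) :: Z.map (of K W))),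
    map_sumPrefix (of K W).toAddMonoidHom (of K W) _ (fun p s => (cocyclePair K W).listOp
      (X.map (of K W) ++ (cocyclePair K W).listOp (of K W b :: p) :: s))] at h1
  · exact sub_eq_zero.mpr h1
  · intro p s
    have := listOp_map_of (K := K) (b :: p)
    rw [List.map_cons] at this
    rw [this]
    exact (listOp_map_of _).symm.trans (by simp)
  · intro p s
    have := listOp_map_of (K := K) (s ++ [b])
    rw [List.map_append, List.map_singleton] at this
    rw [this]
    exact (listOp_map_of _).symm.trans (by simp)

/-- The relations of an `𝒩`-algebra make the cocycle on `Tᶜ(W)` associative when the middle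
argument is a letter. -/
theorem d_assoc_of (b : W) (x z : TensorCoalg K W) :
    (cocyclePair K W).d ((cocyclePair K W).d x (of K W b)) z =
      (cocyclePair K W).d x ((cocyclePair K W).d (of K W b) z) := by
  induction x using induction_prod with
  | prod a l =>
    induction z using induction_prod with
    | prod c m =>
      have hS : ∀ L : List (TensorCoalg K W), (∀ x ∈ L, x ∈ Set.range (of K W)) →
          ∃ L' : List W, L'.map (of K W) = L := fun L hL =>
        Set.mem_range.mp (Set.range_list_map (of K W) ▸ hL)
      refine sub_eq_zero.mp ((cocyclePair K W).associator_prod_eq_zero (Set.range (of K W))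
        ?_ ?_ ⟨b, rfl⟩ ?_)
      · rintro X _ Z hX ⟨b, rfl⟩ hZ hX' hZ'
        obtain ⟨X, rfl⟩ := hS X hX
        obtain ⟨Z, rfl⟩ := hS Z hZ
        exact relDefect_map_of (by simpa using hX') b (by simpa using hZ')
      · simp
      · simp
    | add x y hx hy => simp only [map_add, hx, hy]
    | smul k x hx => simp only [map_smul, hx]
  | add x y hx hy => simp only [map_add, LinearMap.add_apply, hx, hy]
  | smul k x hx => simp only [map_smul, LinearMap.smul_apply, hx]

/-- The relations of an `𝒩`-algebra make the cocycle on `Tᶜ(W)` associative: as the associator of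
a cocycle is a cocycle, it vanishes as soon as it does for a letter in the middle. -/
theorem associator_eq_zero (x y z : TensorCoalg K W) :
    (cocyclePair K W).associator x y z = 0 := by
  have base : ∀ b x z, (cocyclePair K W).associator x (of K W b) z = 0 := fun b x z =>
    sub_eq_zero.mpr (d_assoc_of b x z)
  refine sub_eq_zero.mpr ?_
  induction y using induction_concat generalizing x z with
  | of b => exact d_assoc_of b x z
  | add y y' hy hy' => simp only [map_add, LinearMap.add_apply, hy, hy']
  | smul c y hy => simp only [map_smul, LinearMap.smul_apply, hy]
  | concat y u hy =>
    have hy' : ∀ x z, (cocyclePair K W).associator x y z = 0 := fun x z => sub_eq_zero.mpr (hy x z)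
    refine sub_eq_zero.mp (((cocyclePair K W).associator_mul_mid x y (of K W u) z).trans ?_)
    simp only [base, hy', map_zero, LinearMap.zero_apply, add_zero, sub_self]

/-! ### Extending morphisms of `𝒩`-algebras to words -/

section Lift

variable {A : Type*} [AddCommGroup A] [Module K A] (Q : CocyclePair K A) (ψ : W →ₗ[K] A)

theorem lift_prod (a : W) (l : List W) :
    lift Q.mul ψ ((cocyclePair K W).prod (of K W a) (l.map (of K W))) = Q.prod (ψ a) (l.map ψ) := by
  induction l generalizing a with
  | nil => exact lift_of _ _ _
  | cons b l ih =>
    rw [List.map_cons, List.map_cons, CocyclePair.prod_cons, CocyclePair.prod_cons, cocyclePair_mul,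
      mul_of, lift_cons, ih]

theorem map_onList_op (hψ : ∀ n x, ψ (NAlgebra.op (K := K) n x) = Q.opMap n (fun i => ψ (x i)))
    (l : List W) : ψ (onList (fun n => NAlgebra.op (K := K) (A := W) n) l) =
      Q.listOp (l.map ψ) := by
  rw [← CocyclePair.onList_opMap]
  exact map_onList _ _ ψ (map_zero ψ) hψ l

/-- The multiplicative extension of a morphism of `𝒩`-algebras respects the cocycles. -/
theorem lift_d (hψ : ∀ n x, ψ (NAlgebra.op (K := K) n x) = Q.opMap n (fun i => ψ (x i)))
    (x y : TensorCoalg K W) : lift Q.mul ψ ((cocyclePair K W).d x y) =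
      Q.d (lift Q.mul ψ x) (lift Q.mul ψ y) := by
  -- Appending a letter `z` to `y` changes both sides by an operation ending in `z`.
  have hlast : ∀ (w : W) (y : TensorCoalg K W) (z : W),
      ψ (evalOp K W (cons K W w (mul K W y (of K W z)))) =
        Q.d (ψ w) (Q.mul (lift Q.mul ψ y) (ψ z)) - Q.mul (Q.d (ψ w) (lift Q.mul ψ y)) (ψ z) := by
    intro w y z
    induction y using induction_prod with
    | prod a l =>
      have : cons K W w (mul K W ((cocyclePair K W).prod (of K W a) (l.map (of K W))) (of K W z)) =
          (cocyclePair K W).prod (of K W w) ((a :: (l ++ [z])).map (of K W)) := by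
        rw [List.map_cons, CocyclePair.prod_cons, List.map_append, List.map_singleton,
          CocyclePair.prod_concat, cocyclePair_mul, mul_of]
      rw [this, evalOp_prod, map_onList_op Q ψ hψ, lift_prod, List.map_cons, List.map_cons,
        List.map_append, List.map_singleton, CocyclePair.listOp_cons, CocyclePair.theta_concat]
    | add x y hx hy =>
      simp only [map_add, LinearMap.add_apply, hx, hy]
      abel
    | smul c x hx => simp only [map_smul, LinearMap.smul_apply, hx, smul_sub]
  have hof : ∀ (w : W) (y : TensorCoalg K W), lift Q.mul ψ ((cocyclePair K W).d (of K W w) y) =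
      Q.d (ψ w) (lift Q.mul ψ y) := by
    intro w y
    induction y using induction_concat with
    | of z =>
      have := evalOp_prod (K := K) w [z]
      rw [List.map_singleton, CocyclePair.prod_cons, CocyclePair.prod_nil, cocyclePair_mul,
        mul_of] at this
      rw [d_of_of, lift_of, lift_of, this, map_onList_op Q ψ hψ]
      rfl
    | add y y' hy hy' => simp only [map_add, hy, hy']
    | smul c y hy => simp only [map_smul, hy]
    | concat y z hy =>
      rw [d_of_concat, map_add, lift_mul _ _ Q.assoc, hy, lift_of, lift_of, hlast,
        lift_mul _ _ Q.assoc, lift_of, add_sub_cancel]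
  induction x using induction_cons generalizing y with
  | of w => rw [hof, lift_of]
  | add x x' hx hx' => simp only [map_add, LinearMap.add_apply, hx, hx']
  | smul c x hx => simp only [map_smul, LinearMap.smul_apply, hx]
  | cons w x hx =>
    have h1 := congrArg (lift Q.mul ψ) ((cocyclePair K W).cocycle (of K W w) x y)
    have h2 := Q.cocycle (ψ w) (lift Q.mul ψ x) (lift Q.mul ψ y)
    simp only [cocyclePair_mul, map_add, lift_mul _ _ Q.assoc, mul_of, lift_cons, hof, hx] at h1
    rw [lift_cons]
    exact add_right_cancel (h1.trans h2.symm)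

end Lift

end NAlgebra

end TensorCoalg

/-! ### The isomorphism -/

section Isomorphism

open CompatAssocAlgebra

variable (K V : Type*) [Field K] [AddCommGroup V] [Module K V]

/-- The compatible associative algebra structure on `Tᶜ(W)` given by an `𝒩`-algebra `W`. -/
abbrev TensorCoalg.compatAssocAlgebra (W : Type*) [AddCommGroup W] [Module K W] [NAlgebra K W] :
    CompatAssocAlgebra K (TensorCoalg K W) :=
  (TensorCoalg.cocyclePair K W).toCompatAssocAlgebra TensorCoalg.associator_eq_zero

/-- The morphism of compatible associative algebras `As²(V) → Tᶜ(𝒩(V))` extending the inclusion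
of `V`. -/
def FreeCompat.toWords : FreeCompat K V →ₗ[K] TensorCoalg K (FreeN K V) :=
  letI := TensorCoalg.compatAssocAlgebra K (FreeN K V)
  FreeCompat.lift (TensorCoalg.of K (FreeN K V) ∘ₗ FreeN.ι K V)

/-- The morphism of `𝒩`-algebras `𝒩(V) → As²(V)` extending the inclusion of `V`. -/
def FreeN.toCompat : FreeN K V →ₗ[K] FreeCompat K V :=
  letI := (CocyclePair.ofCompat K (FreeCompat K V)).toNAlgebra CocyclePair.ofCompat_associator
  FreeN.lift (FreeCompat.ι K V)

/-- The multiplicative extension of `FreeN.toCompat`. -/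
def FreeCompat.ofWords : TensorCoalg K (FreeN K V) →ₗ[K] FreeCompat K V :=
  TensorCoalg.lift (CocyclePair.ofCompat K (FreeCompat K V)).mul (FreeN.toCompat K V)

variable {K V}

theorem FreeCompat.toWords_ι (v : V) :
    toWords K V (ι K V v) = TensorCoalg.of K _ (FreeN.ι K V v) := rfl

theorem FreeCompat.toWords_dot (x y : FreeCompat K V) : toWords K V (dot (K := K) x y) =
    TensorCoalg.mul K (FreeN K V) (toWords K V x) (toWords K V y) :=
  letI := TensorCoalg.compatAssocAlgebra K (FreeN K V)
  lift_dot (TensorCoalg.of K (FreeN K V) ∘ₗ FreeN.ι K V) x y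

theorem FreeCompat.toWords_circ (x y : FreeCompat K V) : toWords K V (circ (K := K) x y) =
    TensorCoalg.mul K (FreeN K V) (toWords K V x) (toWords K V y) +
      (TensorCoalg.cocyclePair K (FreeN K V)).d (toWords K V x) (toWords K V y) :=
  letI := TensorCoalg.compatAssocAlgebra K (FreeN K V)
  lift_circ (TensorCoalg.of K (FreeN K V) ∘ₗ FreeN.ι K V) x y

theorem FreeN.toCompat_op (n : ℕ) (x : Fin (n + 2) → FreeN K V) :
    toCompat K V (NAlgebra.op (K := K) n x) =
      (CocyclePair.ofCompat K (FreeCompat K V)).opMap n (fun i => toCompat K V (x i)) :=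
  letI := (CocyclePair.ofCompat K (FreeCompat K V)).toNAlgebra CocyclePair.ofCompat_associator
  lift_op (FreeCompat.ι K V) n x

theorem FreeCompat.ofWords_toWords (x : FreeCompat K V) : ofWords K V (toWords K V x) = x := by
  induction x using FreeCompat.induction_on with
  | of v => exact TensorCoalg.lift_of _ _ _
  | zero => simp
  | add x y hx hy => rw [map_add, map_add, hx, hy]
  | smul c x hx => rw [map_smul, map_smul, hx]
  | dot x y hx hy =>
    rw [toWords_dot, ofWords, TensorCoalg.lift_mul _ _
      (CocyclePair.ofCompat K (FreeCompat K V)).assoc, ← ofWords, hx, hy]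
    rfl
  | circ x y hx hy =>
    rw [toWords_circ, map_add, ofWords, TensorCoalg.lift_mul _ _
      (CocyclePair.ofCompat K (FreeCompat K V)).assoc,
      TensorCoalg.lift_d _ _ FreeN.toCompat_op, ← ofWords, hx, hy]
    exact add_sub_cancel _ _

/-- Both sides are morphisms of `𝒩`-algebras. -/
theorem FreeCompat.toWords_toCompat (w : FreeN K V) :
    toWords K V (FreeN.toCompat K V w) = TensorCoalg.of K _ w := by
  induction w using FreeN.induction_on with
  | of v => rfl
  | zero => simp
  | add x y hx hy => rw [map_add, map_add, map_add, hx, hy]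
  | smul c x hx => rw [map_smul, map_smul, map_smul, hx]
  | op n x hx =>
    have h : ∀ x y, toWords K V ((CocyclePair.ofCompat K (FreeCompat K V)).d x y) =
        (TensorCoalg.cocyclePair K (FreeN K V)).d (toWords K V x) (toWords K V y) := by
      intro x y
      change toWords K V (circ (K := K) x y - dot (K := K) x y) = _
      rw [map_sub, toWords_circ, toWords_dot, add_sub_cancel_left]
    rw [FreeN.toCompat_op, ← onList_ofFn (fun n => NAlgebra.op (K := K) (A := FreeN K V) n),
      ← TensorCoalg.listOp_map_of]
    refine ((CocyclePair.ofCompat K (FreeCompat K V)).map_listOp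
      (TensorCoalg.cocyclePair K (FreeN K V))
      (toWords K V) toWords_dot h _).trans ?_
    rw [List.map_ofFn, List.map_ofFn]
    exact congrArg (fun f => CocyclePair.listOp _ (List.ofFn f)) (funext hx)

theorem FreeCompat.toWords_ofWords (x : TensorCoalg K (FreeN K V)) :
    toWords K V (ofWords K V x) = x := by
  induction x using TensorCoalg.induction_cons with
  | of w => rw [ofWords, TensorCoalg.lift_of, toWords_toCompat]
  | add x y hx hy => rw [map_add, map_add, hx, hy]
  | smul c x hx => rw [map_smul, map_smul, hx]
  | cons w x hx =>
    rw [ofWords, TensorCoalg.lift_cons, ← ofWords]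
    exact (toWords_dot _ _).trans (by rw [hx, toWords_toCompat, TensorCoalg.mul_of])

theorem FreeCompat.comul_toWords (x : FreeCompat K V) :
    TensorCoalg.comul K _ (toWords K V x) =
      TensorProduct.map (toWords K V) (toWords K V) (comul K V x) := by
  have hr : ∀ (f : FreeCompat K V →ₗ[K] FreeCompat K V)
      (g : TensorCoalg K (FreeN K V) →ₗ[K] TensorCoalg K (FreeN K V)),
      (∀ z, toWords K V (f z) = g (toWords K V z)) → ∀ t,
      TensorProduct.map (toWords K V) (toWords K V) (f.rTensor _ t) =
        g.rTensor _ (TensorProduct.map (toWords K V) (toWords K V) t) := by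
    intro f g h t
    induction t using TensorProduct.induction_on with
    | zero => simp only [map_zero]
    | tmul x y => simp only [LinearMap.rTensor_tmul, TensorProduct.map_tmul, h]
    | add x y hx hy => simp only [map_add, hx, hy]
  have hl : ∀ (f : FreeCompat K V →ₗ[K] FreeCompat K V)
      (g : TensorCoalg K (FreeN K V) →ₗ[K] TensorCoalg K (FreeN K V)),
      (∀ z, toWords K V (f z) = g (toWords K V z)) → ∀ t,
      TensorProduct.map (toWords K V) (toWords K V) (f.lTensor _ t) =
        g.lTensor _ (TensorProduct.map (toWords K V) (toWords K V) t) := by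
    intro f g h t
    induction t using TensorProduct.induction_on with
    | zero => simp only [map_zero]
    | tmul x y => simp only [LinearMap.lTensor_tmul, TensorProduct.map_tmul, h]
    | add x y hx hy => simp only [map_add, hx, hy]
  induction x using FreeCompat.induction_on with
  | of v => rw [toWords_ι, TensorCoalg.comul_of, comul_ι, map_zero]
  | zero => simp only [map_zero]
  | add x y hx hy => simp only [map_add, hx, hy]
  | smul c x hx => simp only [map_smul, hx]
  | dot x y hx hy =>
    rw [toWords_dot, TensorCoalg.comul_mul, hx, hy, comul_dot, map_add, map_add,
      TensorProduct.map_tmul, hr _ _ (toWords_dot x),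
      hl _ ((TensorCoalg.mul K (FreeN K V)).flip (toWords K V y)) fun z => toWords_dot z y]
  | circ x y hx hy =>
    rw [toWords_circ, map_add, TensorCoalg.comul_mul, TensorCoalg.comul_d, hx, hy, comul_circ,
      map_add, map_add, TensorProduct.map_tmul,
      hr _ (TensorCoalg.mul K (FreeN K V) (toWords K V x) +
        (TensorCoalg.cocyclePair K (FreeN K V)).d (toWords K V x)) (toWords_circ x),
      hl _ ((TensorCoalg.mul K (FreeN K V)).flip (toWords K V y) +
        (TensorCoalg.cocyclePair K (FreeN K V)).d.flip (toWords K V y)) fun z => toWords_circ z y,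
      LinearMap.rTensor_add, LinearMap.lTensor_add, LinearMap.add_apply, LinearMap.add_apply]
    abel

end Isomorphism

end

/-- The free compatible associative algebra `As²(V)` is isomorphic, as a coalgebra, to the cofree
conilpotent coalgebra `Tᶜ(𝒩(V))` on the free `𝒩`-algebra on `V`. -/
theorem mainTheorem1 (K : Type*) [Field K] (V : Type*) [AddCommGroup V] [Module K V] :
    ∃ e : FreeCompat K V ≃ₗ[K] TensorCoalg K (FreeN K V),
      TensorProduct.map e.toLinearMap e.toLinearMap ∘ₗ FreeCompat.comul K V =
        TensorCoalg.comul K (FreeN K V) ∘ₗ e.toLinearMap :=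
  ⟨LinearEquiv.ofLinearMap (FreeCompat.toWords K V) (FreeCompat.ofWords K V)
    (LinearMap.ext FreeCompat.toWords_ofWords) (LinearMap.ext FreeCompat.ofWords_toWords),
    LinearMap.ext fun x => (FreeCompat.comul_toWords x).symm⟩
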